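/- Let $n\ge 0$, let $V=\{x_1,\dots,x_n\}$ be propositional variables and let $\pi\in S_n$ be an order on them ($\pi(i)$ is the position of $x_i$). Write $x_i^1$ for $x_i$ and $x_i^0$ for $\bar x_i$. A clause is a set of literals in which no variable appears together with its negation, and a CNF is a set of clauses. The resolution rule derives the clause $C\lor D$ from clauses $C\lor x_i^a$ and $D\lor x_i^{1-a}$ $(a\in\{0,1\})$, where $x_i$ occurs neither in $C$ nor in $D$. In $\pi$-ordered resolution the rule may be applied only if every literal of $C\lor D$ has a variable $x_j$ with $\pi(j)<\pi(i)$; in $\pi$-half-ordered resolution it may be applied only if this holds for all literals of $C$ or for all literals of $D$. There is no weakening rule. A refutation of a CNF $\tau$ is a sequence of lines in which the empty clause occurs; each line is a clause that is either marked as an axiom and belongs to $\tau$, or is obtained by the (restricted) rule from two specified earlier lines. Its size $|\Pi|$ is its number of lines. A system $P$ p-simulates a system $Q$ if there is a single algorithm, for all $n$ and $\pi$, that takes $\pi$ and any $Q$-refutation $\Pi$ with respect to $\pi$, runs in time polynomial in the length of this input, and outputs a $P$-refutation $\Pi'$ with respect to $\pi$, such that $\Pi'$ refutes every CNF $\tau$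 that $\Pi$ refutes (it uses no other axioms) and $|\Pi'|$ is bounded by a polynomial in $|\Pi|$. Two systems are polynomially equivalent if they p-simulate each other. **Theorem 2.1.** $\pi$-ordered resolution and $\pi$-half-ordered resolution are polynomially equivalent, uniformly in $n$ and in the order $\pi\in S_n$. Moreover, the p-simulation of $\pi$-half-ordered by $\pi$-ordered resolution can be chosen such that, for all $n\ge 1$, it takes every $\pi$-half-ordered refutation $\Pi$ to a $\pi$-ordered refutation $\Pi'$ with $|\Pi'|\le n\,|\Pi|$. -/

import Mathlib

/-! Clauses and resolution over the variables `x_i`, `i : Fin n`. -/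

namespace OrdRes

/-- The literal `x_i^a`: `(i, true)` is the variable `x_i`, `(i, false)` is its negation. -/
abbrev Lit (n : ℕ) : Type := Fin n × Bool

/-- A clause: a set of literals in which no variable occurs together with its negation. -/
@[ext]
structure Clause (n : ℕ) where
  lits : Finset (Lit n)
  consistent : ∀ i : Fin n, ¬ ((i, true) ∈ lits ∧ (i, false) ∈ lits)

/-- How a line of a proof is justified: it is an axiom, or it is obtained by the resolution rule
from the lines number `j` and `k` (lines are numbered from `0`). -/
inductive Just : Type
  | ax : Just
  | res (j k : ℕ) : Just

/-- A line of a proof: a clause together with its justification. -/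
structure Line (n : ℕ) where
  clause : Clause n
  just : Just

/-- A (candidate) resolution proof is a sequence of lines; its size is its length. -/
abbrev Proof (n : ℕ) : Type := List (Line n)

/-- A subsystem of resolution, uniform in the number `n` of variables and in the order `π`
(`π i` is the position of the variable `x_i`): it tells which instances
`C ∨ x_i^a, D ∨ x_i^(1-a) ⊢ C ∨ D` of the resolution rule are allowed.
The arguments are `n`, `π`, `i`, `C`, `D`. -/
abbrev System : Type :=
  (n : ℕ) → Equiv.Perm (Fin n) → Fin n → Finset (Lit n) → Finset (Lit n) → Prop

/-- `π`-ordered resolution: all variables of `C ∨ D` are smaller than the resolved one. -/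
def ordered : System := fun _ π i C D => ∀ l ∈ C ∪ D, π l.1 < π i

/-- `π`-half-ordered resolution: in at least one of the two antecedents
all other variables are smaller than the resolved one. -/
def halfOrdered : System := fun _ π i C D =>
  (∀ l ∈ C, π l.1 < π i) ∨ (∀ l ∈ D, π l.1 < π i)

/-- `G` follows from `E = C ∨ x_i^a` and `F = D ∨ x_i^(1-a)` by an allowed instance of the
resolution rule, where `C` and `D` are `E` and `F` without the resolved literals.
Note that `G`, being a clause, is not a tautology. -/
def Infers (S : System) {n : ℕ} (π : Equiv.Perm (Fin n)) (E F G : Clause n) : Prop :=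
  ∃ (i : Fin n) (a : Bool), (i, a) ∈ E.lits ∧ (i, !a) ∈ F.lits ∧
    S n π i (E.lits.erase (i, a)) (F.lits.erase (i, !a)) ∧
    G.lits = E.lits.erase (i, a) ∪ F.lits.erase (i, !a)

/-- The line `L`, at place `t` of the sequence `P`, is correctly justified with axioms from `τ`. -/
def LineOK (S : System) {n : ℕ} (π : Equiv.Perm (Fin n)) (τ : Set (Clause n))
    (P : Proof n) (t : ℕ) (L : Line n) : Prop :=
  match L.just with
  | Just.ax => L.clause ∈ τ
  | Just.res j k => j < t ∧ k < t ∧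
      ∃ A B : Line n, P[j]? = some A ∧ P[k]? = some B ∧ Infers S π A.clause B.clause L.clause

/-- `P` is a proof in the system `S`, with respect to the order `π`, from the CNF `τ`. -/
def IsProof (S : System) {n : ℕ} (π : Equiv.Perm (Fin n)) (τ : Set (Clause n))
    (P : Proof n) : Prop :=
  ∀ (t : ℕ) (L : Line n), P[t]? = some L → LineOK S π τ P t L

/-- `P` is a refutation of `τ`: a proof from `τ` in which the empty clause occurs. -/
def Refutes (S : System) {n : ℕ} (π : Equiv.Perm (Fin n)) (τ : Set (Clause n))
    (P : Proof n) : Prop :=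
  IsProof S π τ P ∧ ∃ L ∈ P, L.clause.lits = ∅

/-! Algorithms: while programs over binary trees (S-expressions), with a running time.

Every instruction that reads or builds a value is charged the size of that value, written
out as a tree without sharing. So every value that occurs in a computation has size at most the
size of the input plus the running time, and the functions computable in polynomial time are
the same as for Turing machines. -/

/-- Data values: binary trees. -/
inductive Data : Type
  | nil : Data
  | cons (a b : Data) : Data

namespace Data

def size : Data → ℕ
  | nil => 1
  | cons a b => a.size + b.size + 1

def head : Data → Data
  | nil => nil
  | cons a _ => a

def tail : Data → Data
  | nil => nil
  | cons _ b => b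

end Data

/-- Programs; each one computes a partial function from data to data. -/
inductive Prog : Type
  | id : Prog
  | nil : Prog
  | head : Prog
  | tail : Prog
  /-- `v ↦ cons (f v) (g v)` -/
  | cons (f g : Prog) : Prog
  /-- First `f`, then `g`. -/
  | seq (f g : Prog) : Prog
  /-- `v ↦ f v` if `c v ≠ nil`, and `v ↦ g v` if `c v = nil`. -/
  | ite (c f g : Prog) : Prog
  /-- As long as `c v ≠ nil`, replace `v` by `f v`; return `v`. -/
  | loop (c f : Prog) : Prog

/-- `Run p v w t`: on input `v`, the program `p` halts with output `w`, in time `t`. -/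
inductive Run : Prog → Data → Data → ℕ → Prop
  | id (v : Data) : Run Prog.id v v v.size
  | nil (v : Data) : Run Prog.nil v Data.nil 1
  | head (v : Data) : Run Prog.head v v.head v.size
  | tail (v : Data) : Run Prog.tail v v.tail v.size
  | cons {f g : Prog} {v a b : Data} {s t : ℕ} (hf : Run f v a s) (hg : Run g v b t) :
      Run (Prog.cons f g) v (Data.cons a b) (s + t + (Data.cons a b).size)
  | seq {f g : Prog} {v u w : Data} {s t : ℕ} (hf : Run f v u s) (hg : Run g u w t) :
      Run (Prog.seq f g) v w (s + t + 1)
  | ite_true {c f g : Prog} {v b w : Data} {s t : ℕ} (hc : Run c v b s) (hb : b ≠ Data.nil)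
      (hf : Run f v w t) : Run (Prog.ite c f g) v w (s + t + 1)
  | ite_false {c f g : Prog} {v w : Data} {s t : ℕ} (hc : Run c v Data.nil s)
      (hg : Run g v w t) : Run (Prog.ite c f g) v w (s + t + 1)
  | loop_done {c f : Prog} {v : Data} {s : ℕ} (hc : Run c v Data.nil s) :
      Run (Prog.loop c f) v v (s + 1)
  | loop_step {c f : Prog} {v b u w : Data} {r s t : ℕ} (hc : Run c v b r) (hb : b ≠ Data.nil)
      (hf : Run f v u s) (hl : Run (Prog.loop c f) u w t) :
      Run (Prog.loop c f) v w (r + s + t + 1)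

/-! Encoding of orders and proofs as data. Natural numbers are written in unary: those that
occur are variables (smaller than `n`, while the order alone takes more than `n` symbols) and line
numbers (smaller than the number of lines), so this is as concise as binary, up to a polynomial. -/

def encNat : ℕ → Data
  | 0 => Data.nil
  | k + 1 => Data.cons Data.nil (encNat k)

def encList : List Data → Data
  | [] => Data.nil
  | a :: l => Data.cons a (encList l)

/-- The order `π`, as the list of the positions of `x_0, …, x_{n-1}`. -/
def encPerm {n : ℕ} (π : Equiv.Perm (Fin n)) : Data :=
  encList (List.ofFn fun i => encNat (π i : ℕ))

/-- A clause, as the list that says for each variable whether it occurs positively (`1`),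
negatively (`2`) or not at all (`0`). -/
def encClause {n : ℕ} (C : Clause n) : Data :=
  encList (List.ofFn fun i =>
    if (i, true) ∈ C.lits then encNat 1 else if (i, false) ∈ C.lits then encNat 2 else encNat 0)

def encJust : Just → Data
  | Just.ax => Data.nil
  | Just.res j k => Data.cons (encNat j) (encNat k)

def encLine {n : ℕ} (L : Line n) : Data := Data.cons (encClause L.clause) (encJust L.just)

def encProof {n : ℕ} (P : Proof n) : Data := encList (P.map encLine)

/-- The input of a simulation: an order together with a proof. -/
def encInput {n : ℕ} (π : Equiv.Perm (Fin n)) (P : Proof n) : Data :=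
  Data.cons (encPerm π) (encProof P)

/-! Simulations. -/

/-- The program `p` is a polynomial-time algorithm that takes every `Q`-refutation, with respect to
any order `π` of any number `n` of variables, to a `P`-refutation with respect to `π` from the
same axioms, whose number of lines is polynomial in that of the given refutation.
The program and the polynomials do not depend on `n` and `π`. -/
def IsPSimulation (P Q : System) (p : Prog) : Prop :=
  ∃ T q : Polynomial ℕ, ∀ (n : ℕ) (π : Equiv.Perm (Fin n)) (τ : Set (Clause n)) (Γ : Proof n),
    Refutes Q π τ Γ →
      ∃ (Δ : Proof n) (t : ℕ), Run p (encInput π Γ) (encProof Δ) t ∧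
        t ≤ T.eval (encInput π Γ).size ∧ Refutes P π τ Δ ∧ Δ.length ≤ q.eval Γ.length

/-- `P` p-simulates `Q`. -/
def PSimulates (P Q : System) : Prop := ∃ p : Prog, IsPSimulation P Q p

/-- `P` and `Q` are polynomially equivalent. -/
def PolyEquivalent (P Q : System) : Prop := PSimulates P Q ∧ PSimulates Q P

end OrdRes

namespace OrdRes

/-! Running time of programs. -/

/-! An ordered inference is half-ordered, so one direction only drops the order from the input.

For the other direction the half-ordered refutation is read line by line, while a list `S` of
clauses derived by ordered resolution grows. The clauses of the given refutation are not themselves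
rederived; only a propagation property is kept. Assume that all literals of a clause `e` are false,
and run through the variables in increasing order: a derived clause whose smaller literals are all
false forces its largest literal to be true. The invariant `Nice S e` says that some derived clause
becomes false in this way and is empty or has its largest literal in `e`. For `e` empty, this gives
the empty clause in `S`.

The invariant survives a half-ordered step up to a conflict (`nice_or_clash`). Let the resolved
variable `x` be the largest one of the antecedent `C ∨ x`. Either `C` alone already has the
property, or a derived clause with largest literal `x` has all its other literals false when `C` is.
Then `x` is forced to be true, which supplies the assumption that the literal `¬x` of the other
antecedent is false, so its propagation can be repeated from the resolvent. The only thing that can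
go wrong is that both literals of `x` become false. In that case the two reasons at the first
conflict are resolved, and the result is resolved with the reason for its largest literal until that
literal is an assumption or the clause is empty (`nice_reduce`). All these steps are ordered.

For the size, one line of the input costs at most one step for the conflict and one for each
propagated variable below it, hence at most `n`. Since `n` is not bounded in terms of the number of
lines, a second count is needed. Each propagated variable is the largest one of some derived clause,
and only the last clause of a reduction can add a new largest variable (`reduce_spec`). So after `t`
lines there are at most `t` such variables, and `t * t` lines have been derived.

The remainder shows that this procedure runs in polynomial time in the given machine model, by
closure properties of `PolyTime` and bounds on all intermediate values. -/

theorem Data.one_le_size (v : Data) : 1 ≤ v.size := by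
  cases v <;> simp [Data.size]

theorem Data.size_head_le (v : Data) : v.head.size ≤ v.size := by
  cases v <;> simp [Data.size, Data.head]; omega

theorem Data.size_tail_le (v : Data) : v.tail.size ≤ v.size := by
  cases v <;> simp [Data.size, Data.tail]; omega

/-- Every newly built value is charged its size. This is what makes outputs, and thereby
compositions, polynomially bounded. -/
theorem Run.size_le {p : Prog} {v w : Data} {t : ℕ} (h : Run p v w t) :
    w.size ≤ v.size + t := by
  induction h with
  | id v => omega
  | nil v => simp [Data.size]
  | head v => have := v.size_head_le; omega
  | tail v => have := v.size_tail_le; omega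
  | cons hf hg ihf ihg => omega
  | seq hf hg ihf ihg => omega
  | ite_true hc hb hf ihc ihf => omega
  | ite_false hc hg ihc ihg => omega
  | loop_done hc ihc => omega
  | loop_step hc hb hf hl ihc ihf ihl => omega

/-- Needed because the bound `n * Γ.length` is claimed for every output of the program. -/
theorem Run.deterministic {p : Prog} {v w : Data} {t : ℕ} (h : Run p v w t) :
    ∀ {w' : Data} {t' : ℕ}, Run p v w' t' → w = w' := by
  induction h with
  | id v => intro _ _ h; cases h; rfl
  | nil v => intro _ _ h; cases h; rfl
  | head v => intro _ _ h; cases h; rfl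
  | tail v => intro _ _ h; cases h; rfl
  | cons hf hg ihf ihg =>
    intro _ _ h
    cases h with
    | cons hf' hg' => rw [ihf hf', ihg hg']
  | seq hf hg ihf ihg =>
    intro _ _ h
    cases h with
    | seq hf' hg' => obtain rfl := ihf hf'; exact ihg hg'
  | ite_true hc hb hf ihc ihf =>
    intro _ _ h
    cases h with
    | ite_true hc' hb' hf' => exact ihf hf'
    | ite_false hc' hg' => exact absurd (ihc hc') hb
  | ite_false hc hg ihc ihg =>
    intro _ _ h
    cases h with
    | ite_true hc' hb' hf' => exact absurd (ihc hc').symm hb'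
    | ite_false hc' hg' => exact ihg hg'
  | loop_done hc ihc =>
    intro _ _ h
    cases h with
    | loop_done hc' => rfl
    | loop_step hc' hb' hf' hl' => exact absurd (ihc hc').symm hb'
  | loop_step hc hb hf hl ihc ihf ihl =>
    intro _ _ h
    cases h with
    | loop_done hc' => exact absurd (ihc hc') hb
    | loop_step hc' hb' hf' hl' => obtain rfl := ihf hf'; exact ihl hl'

theorem eval_mono (T : Polynomial ℕ) {a b : ℕ} (h : a ≤ b) : T.eval a ≤ T.eval b := by
  simp only [Polynomial.eval_eq_sum, Polynomial.sum]
  gcongr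

/-! Encodings of types, and functions computable in polynomial time. -/

/-- A type whose elements are written as data. -/
class Enc (α : Type) where
  enc : α → Data

open Enc (enc)

instance : Enc Unit := ⟨fun _ => Data.nil⟩

/-- The value `true` is written as `nil`, so that the encoding of `Option Bool` is the one used
for the entries of a clause. -/
instance : Enc Bool := ⟨fun b => if b then Data.nil else Data.cons Data.nil Data.nil⟩

instance : Enc ℕ := ⟨encNat⟩

instance {α : Type} [Enc α] : Enc (Option α) :=
  ⟨fun o => o.elim Data.nil fun a => Data.cons Data.nil (enc a)⟩

instance {α β : Type} [Enc α] [Enc β] : Enc (α × β) :=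
  ⟨fun x => Data.cons (enc x.1) (enc x.2)⟩

instance {α : Type} [Enc α] : Enc (List α) := ⟨fun l => encList (l.map enc)⟩

instance : Enc Just := ⟨encJust⟩

/-! ### Sizes of encoded values and polynomial bounds -/

/-- The size of the data that encode `a`. -/
def sz {α : Type} [Enc α] (a : α) : ℕ := (enc a).size

section

variable {α β γ δ σ : Type} [Enc α] [Enc β] [Enc γ] [Enc δ] [Enc σ]

theorem one_le_sz (a : α) : 1 ≤ sz a := Data.one_le_size _

theorem sz_pair (a : α) (b : β) : sz (a, b) = sz a + sz b + 1 := rfl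

theorem sz_nil : sz ([] : List α) = 1 := rfl

theorem sz_cons (a : α) (l : List α) : sz (a :: l) = sz a + sz l + 1 := rfl

theorem sz_none : sz (none : Option α) = 1 := rfl

theorem sz_some (a : α) : sz (some a) = sz a + 2 := by
  change 1 + sz a + 1 = _
  omega

theorem sz_nat (k : ℕ) : sz k = 2 * k + 1 := by
  induction k with
  | zero => rfl
  | succ k ih =>
    change 1 + sz k + 1 = _
    omega

theorem sz_ax : sz Just.ax = 1 := rfl

theorem sz_res (j k : ℕ) : sz (Just.res j k) = 2 * j + 2 * k + 3 := by
  change sz j + sz k + 1 = _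
  rw [sz_nat, sz_nat]
  omega

theorem sz_list_le {l : List α} {M : ℕ} (h : ∀ a ∈ l, sz a ≤ M) :
    sz l ≤ l.length * (M + 1) + 1 := by
  induction l with
  | nil => simp [sz_nil]
  | cons a l ih =>
    have h1 := h a (by simp)
    have h2 := ih fun b hb => h b (by simp [hb])
    rw [sz_cons, List.length_cons, Nat.succ_mul]
    omega

theorem length_le_sz (l : List α) : l.length ≤ sz l := by
  induction l with
  | nil => simp
  | cons a l ih => rw [sz_cons, List.length_cons]; omega

theorem sz_le_of_mem {l : List α} {a : α} (h : a ∈ l) : sz a ≤ sz l := by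
  induction l with
  | nil => simp at h
  | cons b l ih =>
    rw [sz_cons]
    rcases List.mem_cons.1 h with rfl | h
    · omega
    · have := ih h; omega

theorem sz_suffix_le {l m : List α} (h : l <:+ m) : sz l ≤ sz m := by
  obtain ⟨k, rfl⟩ := h
  induction k with
  | nil => simp
  | cons b l ih => rw [List.cons_append, sz_cons]; omega

theorem sz_prefix_le {l m : List α} (h : l <+: m) : sz l ≤ sz m := by
  obtain ⟨k, rfl⟩ := h
  induction l with
  | nil => exact one_le_sz _
  | cons b l ih => rw [List.cons_append, sz_cons, sz_cons]; omega

/-- `g a` is at most polynomial in the size of `a`. -/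
def PolyBound (g : α → ℕ) : Prop := ∃ T : Polynomial ℕ, ∀ a, g a ≤ T.eval (sz a)

namespace PolyBound

theorem mono {f g : α → ℕ} (hg : PolyBound g) (h : ∀ a, f a ≤ g a) : PolyBound f := by
  obtain ⟨T, hT⟩ := hg
  exact ⟨T, fun a => (h a).trans (hT a)⟩

theorem const (k : ℕ) : PolyBound fun _ : α => k := ⟨Polynomial.C k, fun a => by simp⟩

theorem size : PolyBound fun a : α => sz a := ⟨Polynomial.X, fun a => by simp⟩

theorem add {f g : α → ℕ} (hf : PolyBound f) (hg : PolyBound g) :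
    PolyBound fun a => f a + g a := by
  obtain ⟨S, hS⟩ := hf
  obtain ⟨T, hT⟩ := hg
  exact ⟨S + T, fun a => by rw [Polynomial.eval_add]; exact Nat.add_le_add (hS a) (hT a)⟩

theorem mul {f g : α → ℕ} (hf : PolyBound f) (hg : PolyBound g) :
    PolyBound fun a => f a * g a := by
  obtain ⟨S, hS⟩ := hf
  obtain ⟨T, hT⟩ := hg
  exact ⟨S * T, fun a => by rw [Polynomial.eval_mul]; exact Nat.mul_le_mul (hS a) (hT a)⟩

theorem eval {f : α → ℕ} (hf : PolyBound f) (S : Polynomial ℕ) :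
    PolyBound fun a => S.eval (f a) := by
  obtain ⟨T, hT⟩ := hf
  exact ⟨S.comp T, fun a => by rw [Polynomial.eval_comp]; exact eval_mono S (hT a)⟩

theorem comp {f : β → ℕ} (hf : PolyBound f) {g : α → β} (hg : PolyBound fun a => sz (g a)) :
    PolyBound fun a => f (g a) := by
  obtain ⟨S, hS⟩ := hf
  exact (hg.eval S).mono fun a => hS _

end PolyBound

/-! ### Timed runs and closure properties of polynomial time -/

/-- The program `p` halts on `v` with output `w`, in time at most `T`. -/
def RunLE (p : Prog) (v w : Data) (T : ℕ) : Prop := ∃ t, Run p v w t ∧ t ≤ T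

namespace RunLE

theorem mono {p : Prog} {v w : Data} {S T : ℕ} (h : RunLE p v w S) (hST : S ≤ T) :
    RunLE p v w T := by
  obtain ⟨t, h, ht⟩ := h
  exact ⟨t, h, ht.trans hST⟩

/-- The pair itself is charged its size, and by `Run.size_le` each component is at most `v.size`
plus its own running time; hence the factors 2. -/
theorem cons {f g : Prog} {v a b : Data} {S T : ℕ} (hf : RunLE f v a S) (hg : RunLE g v b T) :
    RunLE (Prog.cons f g) v (Data.cons a b) (2 * S + 2 * T + 2 * v.size + 1) := by
  obtain ⟨s, hf, hs⟩ := hf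
  obtain ⟨t, hg, ht⟩ := hg
  refine ⟨_, Run.cons hf hg, ?_⟩
  have h1 := hf.size_le
  have h2 := hg.size_le
  simp only [Data.size]
  omega

theorem seq {f g : Prog} {v u w : Data} {S T : ℕ} (hf : RunLE f v u S) (hg : RunLE g u w T) :
    RunLE (Prog.seq f g) v w (S + T + 1) := by
  obtain ⟨s, hf, hs⟩ := hf
  obtain ⟨t, hg, ht⟩ := hg
  exact ⟨_, Run.seq hf hg, by omega⟩

theorem ite_true {c f g : Prog} {v b w : Data} {S T : ℕ} (hc : RunLE c v b S)
    (hb : b ≠ Data.nil) (hf : RunLE f v w T) : RunLE (Prog.ite c f g) v w (S + T + 1) := by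
  obtain ⟨s, hc, hs⟩ := hc
  obtain ⟨t, hf, ht⟩ := hf
  exact ⟨_, Run.ite_true hc hb hf, by omega⟩

theorem ite_false {c f g : Prog} {v w : Data} {S T : ℕ} (hc : RunLE c v Data.nil S)
    (hg : RunLE g v w T) : RunLE (Prog.ite c f g) v w (S + T + 1) := by
  obtain ⟨s, hc, hs⟩ := hc
  obtain ⟨t, hg, ht⟩ := hg
  exact ⟨_, Run.ite_false hc hg, by omega⟩

theorem loop_done {c f : Prog} {v : Data} {S : ℕ} (hc : RunLE c v Data.nil S) :
    RunLE (Prog.loop c f) v v (S + 1) := by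
  obtain ⟨s, hc, hs⟩ := hc
  exact ⟨_, Run.loop_done hc, by omega⟩

theorem loop_step {c f : Prog} {v b u w : Data} {R S T : ℕ} (hc : RunLE c v b R)
    (hb : b ≠ Data.nil) (hf : RunLE f v u S) (hl : RunLE (Prog.loop c f) u w T) :
    RunLE (Prog.loop c f) v w (R + S + T + 1) := by
  obtain ⟨r, hc, hr⟩ := hc
  obtain ⟨s, hf, hs⟩ := hf
  obtain ⟨t, hl, ht⟩ := hl
  exact ⟨_, Run.loop_step hc hb hf hl, by omega⟩

end RunLE

/-- The function `f` is computed by a program in polynomial time. -/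
def PolyTime (f : α → β) : Prop :=
  ∃ (p : Prog) (T : α → ℕ), PolyBound T ∧ ∀ a, RunLE p (enc a) (enc (f a)) (T a)

namespace PolyTime

theorem congr {f g : α → β} (hf : PolyTime f) (h : ∀ a, g a = f a) : PolyTime g := by
  rwa [funext h]

theorem bound {f : α → β} (hf : PolyTime f) : PolyBound fun a => sz (f a) := by
  obtain ⟨p, T, hT, h⟩ := hf
  refine (PolyBound.size.add hT).mono fun a => ?_
  obtain ⟨t, hr, ht⟩ := h a
  have := hr.size_le
  exact this.trans (by unfold sz; omega)

/-- A change of type that does not change the data. -/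
theorem of_enc_eq {f : α → β} (h : ∀ a, enc (f a) = enc a) : PolyTime f :=
  ⟨Prog.id, fun a => sz a, PolyBound.size, fun a => by rw [h]; exact ⟨_, Run.id _, le_rfl⟩⟩

theorem id : PolyTime fun a : α => a := of_enc_eq fun _ => rfl

theorem of_head {f : α → β} (h : ∀ a, enc (f a) = (enc a).head) : PolyTime f :=
  ⟨Prog.head, fun a => sz a, PolyBound.size, fun a => by rw [h]; exact ⟨_, Run.head _, le_rfl⟩⟩

theorem of_tail {f : α → β} (h : ∀ a, enc (f a) = (enc a).tail) : PolyTime f :=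
  ⟨Prog.tail, fun a => sz a, PolyBound.size, fun a => by rw [h]; exact ⟨_, Run.tail _, le_rfl⟩⟩

theorem fst : PolyTime fun x : α × β => x.1 := of_head fun _ => rfl

theorem snd : PolyTime fun x : α × β => x.2 := of_tail fun _ => rfl

theorem comp {g : β → γ} (hg : PolyTime g) {f : α → β} (hf : PolyTime f) :
    PolyTime fun a => g (f a) := by
  have hb := hf.bound
  obtain ⟨p, S, hS, h⟩ := hf
  obtain ⟨q, T, hT, h'⟩ := hg
  exact ⟨Prog.seq p q, _, (hS.add (hT.comp hb)).add (.const 1), fun a => (h a).seq (h' _)⟩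

/-- Pairing, into any type whose data are pairs. -/
theorem of_cons {f : α → β} {g : α → γ} (hf : PolyTime f) (hg : PolyTime g) {k : α → δ}
    (hk : ∀ a, enc (k a) = Data.cons (enc (f a)) (enc (g a))) : PolyTime k := by
  obtain ⟨p, S, hS, h⟩ := hf
  obtain ⟨q, T, hT, h'⟩ := hg
  refine ⟨Prog.cons p q, _, ((((PolyBound.const 2).mul hS).add ((PolyBound.const 2).mul hT)).add
    ((PolyBound.const 2).mul .size)).add (.const 1), fun a => ?_⟩
  rw [hk]
  exact (h a).cons (h' a)

theorem pair {f : α → β} {g : α → γ} (hf : PolyTime f) (hg : PolyTime g) :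
    PolyTime fun a => (f a, g a) := of_cons hf hg fun _ => rfl

theorem const (b : β) : PolyTime fun _ : α => b := by
  have key : ∀ d : Data, ∃ p : Prog, ∃ T : α → ℕ, PolyBound T ∧ ∀ a, RunLE p (enc a) d (T a) := by
    intro d
    induction d with
    | nil => exact ⟨Prog.nil, _, .const 1, fun a => ⟨_, Run.nil _, le_rfl⟩⟩
    | cons d e ihd ihe =>
      obtain ⟨p, S, hS, h⟩ := ihd
      obtain ⟨q, T, hT, h'⟩ := ihe
      exact ⟨Prog.cons p q, _, ((((PolyBound.const 2).mul hS).add ((PolyBound.const 2).mul hT)).add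
        ((PolyBound.const 2).mul .size)).add (.const 1), fun a => (h a).cons (h' a)⟩
  exact key (enc b)

/-- Definition by cases, where `c` tells the cases apart. -/
theorem of_ite {c : α → γ} {f g k : α → β} (hc : PolyTime c) (hf : PolyTime f) (hg : PolyTime g)
    (hkf : ∀ a, enc (c a) ≠ Data.nil → k a = f a) (hkg : ∀ a, enc (c a) = Data.nil → k a = g a) :
    PolyTime k := by
  obtain ⟨r, R, hR, h⟩ := hc
  obtain ⟨p, S, hS, h'⟩ := hf
  obtain ⟨q, T, hT, h''⟩ := hg
  refine ⟨Prog.ite r p q, _, (hR.add (hS.add hT)).add (.const 1), fun a => ?_⟩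
  have h0 := h a
  by_cases hn : enc (c a) = Data.nil
  · rw [hkg a hn]
    rw [hn] at h0
    exact (h0.ite_false (h'' a)).mono (by omega)
  · rw [hkf a hn]
    exact (h0.ite_true hn (h' a)).mono (by omega)

theorem cond {c : α → Bool} {f g : α → β} (hc : PolyTime c) (hf : PolyTime f) (hg : PolyTime g) :
    PolyTime fun a => bif c a then f a else g a :=
  -- `true` is written as `nil`, so the two branches change places.
  of_ite hc hg hf (fun a => by cases c a <;> simp [enc]) (fun a => by cases c a <;> simp [enc])

theorem not {c : α → Bool} (hc : PolyTime c) : PolyTime fun a => !(c a) :=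
  (hc.cond (const false) (const true)).congr fun a => by cases c a <;> rfl

theorem and {c d : α → Bool} (hc : PolyTime c) (hd : PolyTime d) : PolyTime fun a => c a && d a :=
  (hc.cond hd (const false)).congr fun a => by cases c a <;> rfl

theorem option_some {f : α → β} (hf : PolyTime f) : PolyTime fun a => Option.some (f a) :=
  of_cons (const ()) hf fun _ => rfl

theorem list_cons {f : α → β} {g : α → List β} (hf : PolyTime f) (hg : PolyTime g) :
    PolyTime fun a => f a :: g a := of_cons hf hg fun _ => rfl

theorem option_elim {o : γ → Option α} {f : γ → β} {g : γ → α → β} (ho : PolyTime o)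
    (hf : PolyTime f) (hg : PolyTime fun x : γ × α => g x.1 x.2) :
    PolyTime fun c => (o c).elim (f c) (g c) := by
  have hb := ho.bound
  obtain ⟨r, R, hR, h⟩ := ho
  obtain ⟨p, S, hS, h'⟩ := hf
  obtain ⟨q, T, ⟨T', hT⟩, h''⟩ := hg
  -- The data of `some a` are `cons nil (enc a)`, so the tail of the output of `r` is paired with
  -- the input. The program `r` runs twice, once as the test.
  refine ⟨Prog.ite r (Prog.seq (Prog.cons Prog.id (Prog.seq r Prog.tail)) q) p, _,
    (((hR.add hS).add (((PolyBound.size.add hb).add (.const 1)).eval T')).add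
      (((PolyBound.const 2).mul hR).add
      (((PolyBound.const 4).mul .size).add ((PolyBound.const 2).mul hb)))).add (.const 6),
    fun c => ?_⟩
  have h0 := h c
  beta_reduce
  generalize o c = oc at h0 ⊢
  cases oc with
  | none =>
    refine RunLE.mono (RunLE.ite_false h0 (h' c)) ?_
    omega
  | some a =>
    have h1 : RunLE (Prog.seq r Prog.tail) (enc c) (enc a) (R c + sz (Option.some a) + 1) :=
      h0.seq ⟨_, Run.tail _, le_rfl⟩
    have h2 : RunLE Prog.id (enc c) (enc c) (sz c) := ⟨_, Run.id _, le_rfl⟩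
    refine RunLE.mono (RunLE.ite_true h0 (by simp [enc])
      ((h2.cons h1).seq (g := q) (h'' (c, a)))) ?_
    have h3 := (hT (c, a)).trans (eval_mono T' (b := sz c + sz (Option.some a) + 1)
      (by rw [sz_pair, sz_some]; omega))
    have h4 : (enc c).size = sz c := rfl
    rw [h4]
    omega

/-- The head and the tail of a list. -/
def _root_.OrdRes.uncons : List α → Option (α × List α)
  | [] => none
  | a :: l => Option.some (a, l)

/-- The data of `a :: l` are those of the pair `(a, l)`, so only a `nil` has to be put in front. -/
theorem list_uncons : PolyTime (uncons : List α → Option (α × List α)) := by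
  have h1 : RunLE Prog.nil (enc ([] : List α)) Data.nil 1 := ⟨_, Run.nil _, le_rfl⟩
  refine ⟨Prog.ite Prog.id (Prog.cons Prog.nil Prog.id) Prog.nil, fun l => 5 * sz l + 10,
    ((PolyBound.const 5).mul .size).add (.const 10), fun l => ?_⟩
  have h2 : RunLE Prog.id (enc l) (enc l) (sz l) := ⟨_, Run.id _, le_rfl⟩
  have h3 : RunLE Prog.nil (enc l) Data.nil 1 := ⟨_, Run.nil _, le_rfl⟩
  cases l with
  | nil =>
    refine (h2.ite_false h3).mono ?_
    change _ ≤ 5 * sz ([] : List α) + 10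
    omega
  | cons a l =>
    refine (h2.ite_true (by simp [enc, encList]) (h3.cons h2)).mono ?_
    have h4 : (enc (a :: l)).size = sz (a :: l) := rfl
    change _ ≤ 5 * sz (a :: l) + 10
    omega

theorem list_tail : PolyTime fun l : List α => l.tail :=
  of_tail fun l => by cases l <;> rfl

theorem nat_pred : PolyTime fun k : ℕ => k - 1 :=
  of_tail fun k => by cases k <;> rfl

theorem nat_succ {f : α → ℕ} (hf : PolyTime f) : PolyTime fun a => f a + 1 :=
  of_cons (const ()) hf fun _ => rfl

theorem list_isEmpty : PolyTime fun l : List α => l.isEmpty :=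
  of_ite (f := fun _ => false) (g := fun _ => true) id (const _) (const _)
    (fun l h => by cases l <;> simp_all [enc, encList])
    (fun l h => by cases l <;> simp_all [enc, encList])

theorem nat_eq_zero : PolyTime fun k : ℕ => k == 0 :=
  of_ite (f := fun _ => false) (g := fun _ => true) id (const _) (const _)
    (fun k h => by cases k <;> simp_all [enc, encNat])
    (fun k h => by cases k <;> simp_all [enc, encNat])

/-- Iteration as long as a condition holds. -/
theorem iterate {s : γ → α} {f : α → α} {c : α → Bool} {k : γ → ℕ} (hs : PolyTime s)
    (hf : PolyTime f) (hc : PolyTime c) (hk : PolyBound k) {B : γ → ℕ} (hB : PolyBound B)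
    (hfB : ∀ a, ∀ i ≤ k a, sz (f^[i] (s a)) ≤ B a)
    (hlt : ∀ a, ∀ i < k a, c (f^[i] (s a)) = true) (hend : ∀ a, c (f^[k a] (s a)) = false) :
    PolyTime fun a => f^[k a] (s a) := by
  -- A loop goes on while its test is not `nil`, that is, not `true`; hence the negated test.
  obtain ⟨q, R, ⟨R', hR⟩, h⟩ := hc.not
  obtain ⟨p, S, ⟨S', hS⟩, h'⟩ := hf
  obtain ⟨p0, T, hT, h0⟩ := hs
  refine ⟨Prog.seq p0 (Prog.loop q p), _, (hT.add ((hk.add (.const 1)).mul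
    (((hB.eval R').add (hB.eval S')).add (.const 1)))).add (.const 1), fun a => (h0 a).seq ?_⟩
  -- Induction on the number `j` of iterations that are still to come.
  have key : ∀ j ≤ k a, RunLE (Prog.loop q p) (enc (f^[k a - j] (s a))) (enc (f^[k a] (s a)))
      ((j + 1) * (R'.eval (B a) + S'.eval (B a) + 1)) := by
    intro j
    induction j with
    | zero =>
      intro _
      have h1 := h (f^[k a] (s a))
      beta_reduce at h1
      rw [hend] at h1
      refine h1.loop_done.mono ?_
      have := (hR (f^[k a] (s a))).trans (eval_mono R' (hfB a (k a) le_rfl))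
      omega
    | succ j ih =>
      intro hj
      have h1 := h (f^[k a - (j + 1)] (s a))
      beta_reduce at h1
      rw [hlt a (k a - (j + 1)) (by omega)] at h1
      have h2 := h' (f^[k a - (j + 1)] (s a))
      rw [← Function.iterate_succ_apply' f, show (k a - (j + 1)).succ = k a - j by omega] at h2
      refine (h1.loop_step (by simp [enc]) h2 (ih (by omega))).mono ?_
      have h3 := (hR (f^[k a - (j + 1)] (s a))).trans
        (eval_mono R' (hfB a (k a - (j + 1)) (by omega)))
      have h4 := (hS (f^[k a - (j + 1)] (s a))).trans
        (eval_mono S' (hfB a (k a - (j + 1)) (by omega)))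
      rw [Nat.succ_mul (j + 1)]
      omega
  simpa using key (k a) le_rfl

/-- A loop on triples of environment, accumulator and remaining list. The bound `hfB` on all
intermediate accumulators is indispensable, as an iterated polynomial-time step may produce
exponentially large values. -/
theorem foldl {l : γ → List α} {s : γ → σ} {f : γ → σ → α → σ} (hl : PolyTime l)
    (hs : PolyTime s) (hf : PolyTime fun x : γ × σ × α => f x.1 x.2.1 x.2.2)
    {B : γ → ℕ} (hB : PolyBound B)
    (hfB : ∀ c l', l' <+: l c → sz (l'.foldl (f c) (s c)) ≤ B c) :
    PolyTime fun c => (l c).foldl (f c) (s c) := by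
  set step : γ × σ × List α → γ × σ × List α := fun x =>
    (OrdRes.uncons x.2.2).elim x fun y => (x.1, f x.1 x.2.1 y.1, y.2) with hstep
  have hit : ∀ c i, step^[i] (c, s c, l c) =
      (c, ((l c).take i).foldl (f c) (s c), (l c).drop i) := by
    intro c i
    induction i with
    | zero => rfl
    | succ i ih =>
      rw [Function.iterate_succ_apply', ih, hstep]
      rcases lt_or_ge i (l c).length with hi | hi
      · rw [List.take_succ_eq_append_getElem hi, List.drop_eq_getElem_cons hi, List.foldl_append]
        rfl
      · simp [List.drop_eq_nil_of_le hi, List.drop_eq_nil_of_le (hi.trans (Nat.le_succ i)),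
          List.take_of_length_le hi, List.take_of_length_le (hi.trans (Nat.le_succ i)),
          OrdRes.uncons]
  have hstep' : PolyTime step := by
    refine option_elim (list_uncons.comp (snd.comp snd)) id (pair (fst.comp fst) (pair
      (PolyTime.comp (f := fun x : (γ × σ × List α) × α × List α => (x.1.1, x.1.2.1, x.2.1))
        hf ?_) (snd.comp snd)))
    exact pair (fst.comp fst) (pair (fst.comp (snd.comp fst)) (fst.comp snd))
  have h := iterate (s := fun c => (c, s c, l c)) (c := fun x : γ × σ × List α => !x.2.2.isEmpty)
    (k := fun c => (l c).length) (pair id (pair hs hl)) hstep'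
    (list_isEmpty.comp (snd.comp snd)).not (hl.bound.mono fun c => length_le_sz _)
    (((PolyBound.size.add hB).add hl.bound).add (.const 2))
    (fun c i _ => by
      rw [hit, sz_pair, sz_pair]
      have h1 := hfB c _ (List.take_prefix i (l c))
      have h2 := sz_suffix_le (List.drop_suffix i (l c))
      omega)
    (fun c i hi => by rw [hit]; simp; omega)
    (fun c => by rw [hit]; simp)
  refine (fst.comp (snd.comp h)).congr fun c => ?_
  rw [hit]
  simp

end PolyTime

end

/-! The simulation, on lists. The clauses are lists that say for each variable, from the last to
the first one in the order, whether and how it occurs; leading variables that do not occur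
may be left out. -/

/-- How a variable occurs in a clause. -/
abbrev Code : Type := Option Bool

/-- A derived line: its number, its clause (which does not start with `none`),
and its justification. -/
abbrev Entry : Type := ℕ × List Code × Just

/-- For each variable, from the last to the first one in the order, its literal that is known to be
false, if any, and in case it is not an assumption the number of the clause by which it is false,
and the smaller variables of this clause. -/
abbrev Trail : Type := List (Code × Option (ℕ × List Code))

/-- All literals of the clause are false according to the trail. -/
def fits : List Code → Trail → Bool
  | [], [] => true
  | a :: r, f :: F => (a == none || a == f.1) && fits r F
  | [], _ :: _ => false
  | _ :: _, [] => false

/-- If the largest literal of the clause is the next variable after those of the trail,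
with sign `b`, and the other literals are false, then these other literals. -/
def candidate (b : Bool) (F : Trail) (E : Entry) : Option (ℕ × List Code) :=
  match E.2.1 with
  | some b' :: r => if b' == b && fits r F then some (E.1, r) else none
  | _ => none

def search (b : Bool) (F : Trail) (S : List Entry) : Option (ℕ × List Code) :=
  S.findSome? (candidate b F)

/-- The union of two clauses. -/
def merge (r g : List Code) : List Code := List.zipWith (fun a c => a.or c) r g

/-- Afterwards the head, if any, is the largest literal, which is where `candidate` and `Has` look
for it. -/
def strip (l : List Code) : List Code := l.dropWhile Option.isNone

/-- Append a derived line. -/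
def push (S : List Entry) (j k : ℕ) (u : List Code) : List Entry :=
  (S.length, strip u, Just.res j k) :: S

/-- Resolve the last clause with the reasons for its largest literals, down to
an assumption. -/
def reduce : List Entry → List Code → Trail → List Entry
  | S, none :: g, _ :: F => reduce S g F
  | S, some _ :: g, (_, some R) :: F =>
    reduce (push S (S.length - 1) R.1 (merge g R.2)) (merge g R.2) F
  | S, some _ :: _, (_, none) :: _ => S
  | S, [], _ => S
  | S, _ :: _, [] => S

/-- Add a variable to the trail; when it turns out that both its literals have
to be false, derive a clause from this conflict. -/
def scanStep (c : Code) (st : List Entry × Option Trail) : List Entry × Option Trail :=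
  match st.2 with
  | none => st
  | some F =>
    match c with
    | some b => (st.1, some ((some b, none) :: F))
    | none =>
      match search true F st.1, search false F st.1 with
      | none, none => (st.1, some ((none, none) :: F))
      | some R, none => (st.1, some ((some false, some R) :: F))
      | none, some R => (st.1, some ((some true, some R) :: F))
      | some R, some R' =>
        (reduce (push st.1 R.1 R'.1 (merge R.2 R'.2)) (merge R.2 R'.2) F, none)

/-- The head of `e` is the largest variable, so `foldr` visits the variables in increasing order. A
trail `none` means that a conflict has been found and the larger variables are skipped. -/
def scan (S : List Entry) (e : List Code) : List Entry × Option Trail :=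
  e.foldr scanStep (S, some [])

/-! Propagation. -/

/-- The clause `cl` has been derived. -/
def Has (S : List Entry) (cl : List Code) : Prop := ∃ E ∈ S, E.2.1 = cl

/-- If all literals of `e` are false, then all literals of `r` are false, by propagation in
increasing order with derived clauses. -/
def Sub (S : List Entry) : (e r : List Code) → Prop
  | [], [] => True
  | c :: e, a :: r => Sub S e r ∧
      (a = none ∨ a = c ∨ ∃ b r', a = some b ∧ Has S (some (!b) :: r') ∧ Sub S e r')
  | [], _ :: _ => False
  | _ :: _, [] => False

/-- If all literals of `e` are false, then propagation makes a derived clause false whose largest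
literal is in `e`. -/
def Nice (S : List Entry) : List Code → Prop
  | [] => Has S []
  | c :: e => Nice S e ∨ ∃ b r, c = some b ∧ Has S (some b :: r) ∧ Sub S e r

/-- If all literals of `e` are false, then propagation makes both literals of some
variable false. -/
def Clash (S : List Entry) : List Code → Prop
  | [] => False
  | _ :: e => Clash S e ∨ ∃ r r', Has S (some true :: r) ∧ Sub S e r ∧
      Has S (some false :: r') ∧ Sub S e r'

/-- Inclusion of clauses. -/
abbrev Le : List Code → List Code → Prop := List.Forall₂ fun a c => a = none ∨ a = c

theorem Has.mono {S S' : List Entry} (h : S ⊆ S') {cl : List Code} : Has S cl → Has S' cl :=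
  fun ⟨E, hE, hc⟩ => ⟨E, h hE, hc⟩

theorem Sub.mono {S S' : List Entry} (h : S ⊆ S') {e r : List Code} (hs : Sub S e r) :
    Sub S' e r := by
  induction e generalizing r with
  | nil => cases r <;> simp_all [Sub]
  | cons c e ih =>
    cases r with
    | nil => simp [Sub] at hs
    | cons a r =>
      refine ⟨ih hs.1, ?_⟩
      rcases hs.2 with h1 | h1 | ⟨b, r', h1, h2, h3⟩
      · exact .inl h1
      · exact .inr (.inl h1)
      · exact .inr (.inr ⟨b, r', h1, h2.mono h, ih h3⟩)

theorem Nice.mono {S S' : List Entry} (h : S ⊆ S') {e : List Code} (hs : Nice S e) :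
    Nice S' e := by
  induction e with
  | nil => exact Has.mono h hs
  | cons c e ih =>
    rcases hs with hs | ⟨b, r, h1, h2, h3⟩
    · exact .inl (ih hs)
    · exact .inr ⟨b, r, h1, h2.mono h, h3.mono h⟩

theorem Sub.le {S : List Entry} {e e' : List Code} (h : Le e e') {r : List Code}
    (hs : Sub S e r) : Sub S e' r := by
  induction h generalizing r with
  | nil => exact hs
  | @cons c c' e e' hc he ih =>
    cases r with
    | nil => simp [Sub] at hs
    | cons a r =>
      refine ⟨ih hs.1, ?_⟩
      rcases hs.2 with h1 | h1 | ⟨b, r', h1, h2, h3⟩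
      · exact .inl h1
      · rcases hc with hc | hc
        · exact .inl (h1.trans hc)
        · exact .inr (.inl (h1.trans hc))
      · exact .inr (.inr ⟨b, r', h1, h2, ih h3⟩)

theorem Nice.le {S : List Entry} {e e' : List Code} (h : Le e e') (hs : Nice S e) :
    Nice S e' := by
  induction h with
  | nil => exact hs
  | @cons c c' e e' hc he ih =>
    rcases hs with hs | ⟨b, r, rfl, h2, h3⟩
    · exact .inl (ih hs)
    · exact .inr ⟨b, r, by rcases hc with hc | hc <;> simp_all, h2, h3.le he⟩

theorem Nice.append {S : List Entry} {e : List Code} (e0 : List Code) (h : Nice S e) :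
    Nice S (e0 ++ e) := by
  induction e0 with
  | nil => exact h
  | cons c e0 ih => exact .inl ih

theorem nice_replicate_none {S : List Entry} {e : List Code} (m : ℕ)
    (h : Nice S (List.replicate m none ++ e)) : Nice S e := by
  induction m with
  | zero => exact h
  | succ m ih =>
    rcases h with h | ⟨b, r, h, -⟩
    · exact ih h
    · cases h

/-- A half-ordered resolution step: propagation either gives a derived clause as wanted
or a conflict. -/
theorem nice_or_clash {S : List Entry} {a : Bool} {c : Code} {e1 e2 e f g : List Code} (m : ℕ)
    (h1 : Le e1 e) (h2 : Le e2 e) (hfg : Le f g)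
    (hn1 : Nice S (List.replicate m none ++ some a :: e1))
    (hn2 : Nice S (f ++ some (!a) :: e2)) :
    Nice S (g ++ c :: e) ∨ Clash S (g ++ c :: e) := by
  -- Either the false clause has its largest literal below the resolved variable, and nothing is to
  -- be done, or that literal is `some a` itself.
  rcases nice_replicate_none m hn1 with hn1 | ⟨b, r, hb, hr, hs⟩
  · exact .inl (Nice.append g (.inl (hn1.le h1)))
  obtain rfl : a = b := Option.some.inj hb
  replace hs := hs.le h1
  -- The derived clause `some a :: r` makes the literal with sign `!a` false, in place of the
  -- assumption that is absent from the resolvent.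
  have hsub : ∀ r', Sub S (f ++ some (!a) :: e2) r' → Sub S (g ++ c :: e) r' := by
    clear hn2
    induction hfg with
    | nil =>
      intro r' hr'
      cases r' with
      | nil => simp [Sub] at hr'
      | cons a' r' =>
        refine ⟨hr'.1.le h2, ?_⟩
        rcases hr'.2 with h3 | h3 | ⟨b', r'', h3, h4, h5⟩
        · exact .inl h3
        · exact .inr (.inr ⟨!a, r, h3, by simpa using hr, hs⟩)
        · exact .inr (.inr ⟨b', r'', h3, h4, h5.le h2⟩)
    | @cons c0 c' e0 e' hc he ih =>
      intro r' hr'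
      cases r' with
      | nil => simp [Sub] at hr'
      | cons a' r' =>
        refine ⟨ih _ hr'.1, ?_⟩
        rcases hr'.2 with h3 | h3 | ⟨b', r'', h3, h4, h5⟩
        · exact .inl h3
        · rcases hc with hc | hc
          · exact .inl (h3.trans hc)
          · exact .inr (.inl (h3.trans hc))
        · exact .inr (.inr ⟨b', r'', h3, h4, ih _ h5⟩)
  have hclash : ∀ r', Has S (some (!a) :: r') → Sub S e r' → Clash S (c :: e) := by
    intro r' h3 h4
    cases a
    · exact .inr ⟨r', r, h3, h4, hr, hs⟩
    · exact .inr ⟨r, r', hr, hs, h3, h4⟩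
  induction hfg with
  | nil =>
    rcases hn2 with hn2 | ⟨b, r', hb, hr', hs'⟩
    · exact .inl (.inl (hn2.le h2))
    · rw [← Option.some.inj hb] at hr'
      exact .inr (hclash r' hr' (hs'.le h2))
  | @cons c0 c' e0 e' hc he ih =>
    have hsub' : ∀ r', Sub S (e0 ++ some (!a) :: e2) r' → Sub S (e' ++ c :: e) r' := by
      intro r' h3
      -- An absent literal on top imposes no condition, so the statement for the shorter lists
      -- follows.
      exact (hsub (none :: r') ⟨h3, .inl rfl⟩).1
    rcases hn2 with hn2 | ⟨b, r', hb, hr', hs'⟩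
    · rcases ih hn2 hsub' with h3 | h3
      · exact .inl (.inl h3)
      · exact .inr (.inl h3)
    · refine .inl (.inr ⟨b, r', ?_, hr', hsub' _ hs'⟩)
      rcases hc with hc | hc
      · rw [hc] at hb; cases hb
      · rw [← hc, hb]

/-! Correctness of the trail and of the reduction. -/

/-- The trail records correct propagations under the assumption that `e` is false. -/
def TrailOK (S : List Entry) : List Code → Trail → Prop
  | [], [] => True
  | c :: e, f :: F => TrailOK S e F ∧
      ((f.1 = c ∧ f.2 = none) ∨ ∃ b R, f = (some b, some R) ∧ fits R.2 F = true ∧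
        ∃ E ∈ S, E.1 = R.1 ∧ E.2.1 = some (!b) :: R.2)
  | [], _ :: _ => False
  | _ :: _, [] => False

theorem TrailOK.length_eq {S : List Entry} {e : List Code} {F : Trail} (h : TrailOK S e F) :
    F.length = e.length := by
  induction e generalizing F with
  | nil => cases F <;> simp_all [TrailOK]
  | cons c e ih =>
    cases F with
    | nil => simp [TrailOK] at h
    | cons f F => simp [ih h.1]

theorem length_eq_of_fits {r : List Code} {F : Trail} (h : fits r F = true) :
    r.length = F.length := by
  induction r generalizing F with
  | nil => cases F <;> simp_all [fits]
  | cons c e ih =>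
    cases F with
    | nil => simp [fits] at h
    | cons f F => simp [fits] at h; simp [ih h.2]

/-- Soundness of the trail: a recorded reason is a derived clause whose smaller part is false by the
trail below it. The converse, completeness, is part of `scan_spec`. -/
theorem TrailOK.sub {S : List Entry} {e : List Code} {F : Trail} (h : TrailOK S e F)
    {r : List Code} (hr : fits r F = true) : Sub S e r := by
  induction e generalizing F r with
  | nil => cases F <;> cases r <;> simp_all [TrailOK, fits, Sub]
  | cons c e ih =>
    cases F with
    | nil => simp [TrailOK] at h
    | cons f F =>
      cases r with
      | nil => simp [fits] at hr
      | cons a r =>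
        simp only [fits, Bool.and_eq_true, Bool.or_eq_true, beq_iff_eq] at hr
        refine ⟨ih h.1 hr.2, ?_⟩
        rcases hr.1 with h1 | h1
        · exact .inl h1
        · rcases h.2 with ⟨h2, -⟩ | ⟨b, R, h2, h3, E, hE, -, h4⟩
          · exact .inr (.inl (h1.trans h2))
          · exact .inr (.inr ⟨b, R.2, by rw [h1, h2], ⟨E, hE, h4⟩, ih h.1 h3⟩)

theorem candidate_eq_some {b : Bool} {F : Trail} {E : Entry} {R : ℕ × List Code} :
    candidate b F E = some R ↔ E.1 = R.1 ∧ E.2.1 = some b :: R.2 ∧ fits R.2 F = true := by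
  obtain ⟨i, cl, J⟩ := E
  obtain ⟨k, r⟩ := R
  unfold candidate
  rcases cl with _ | ⟨_ | b', r'⟩
  · simp
  · simp
  · simp only [Option.ite_none_right_eq_some, Bool.and_eq_true, beq_iff_eq, Option.some.injEq,
      Prod.mk.injEq, List.cons.injEq]
    constructor
    · rintro ⟨⟨rfl, h⟩, rfl, rfl⟩; exact ⟨rfl, ⟨rfl, rfl⟩, h⟩
    · rintro ⟨rfl, ⟨rfl, rfl⟩, h⟩; exact ⟨⟨rfl, h⟩, rfl, rfl⟩

theorem exists_of_search {b : Bool} {F : Trail} {S : List Entry} {R : ℕ × List Code}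
    (h : search b F S = some R) :
    fits R.2 F = true ∧ ∃ E ∈ S, E.1 = R.1 ∧ E.2.1 = some b :: R.2 := by
  obtain ⟨E, hE, h⟩ := List.exists_of_findSome?_eq_some h
  obtain ⟨h1, h2, h3⟩ := candidate_eq_some.1 h
  exact ⟨h3, E, hE, h1, h2⟩

theorem not_fits_of_search {b : Bool} {F : Trail} {S : List Entry} (h : search b F S = none)
    {r : List Code} (hr : Has S (some b :: r)) : ¬ fits r F = true := by
  obtain ⟨E, hE, h1⟩ := hr
  intro hf
  have := List.findSome?_eq_none_iff.1 h E hE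
  have h2 : candidate b F E = some (E.1, r) := candidate_eq_some.2 ⟨rfl, h1, hf⟩
  rw [h2] at this
  cases this

/-- Both clauses agree in sign with the same trail, so their union does too. -/
theorem fits_merge {r g : List Code} {F : Trail} (hr : fits r F = true) (hg : fits g F = true) :
    fits (merge r g) F = true := by
  induction F generalizing r g with
  | nil => cases r <;> cases g <;> simp_all [fits, merge]
  | cons f F ih =>
    cases r with
    | nil => simp [fits] at hr
    | cons a r =>
      cases g with
      | nil => simp [fits] at hg
      | cons c g =>
        simp only [fits, Bool.and_eq_true, Bool.or_eq_true, beq_iff_eq] at hr hg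
        have h := ih hr.2 hg.2
        simp only [merge, List.zipWith_cons_cons, fits, Bool.and_eq_true, Bool.or_eq_true,
          beq_iff_eq] at h ⊢
        refine ⟨?_, h⟩
        rcases hr.1 with h1 | h1
        · simpa [h1] using hg.1
        · cases a with
          | none => simpa using hg.1
          | some b => simp [← h1]

theorem subset_push (S : List Entry) (j k : ℕ) (u : List Code) : S ⊆ push S j k u :=
  List.subset_cons_self _ _

theorem subset_reduce (S : List Entry) (u : List Code) (F : Trail) : S ⊆ reduce S u F := by
  fun_induction reduce S u F with
  | case1 S f g F ih => exact ih
  | case2 S b g a R F ih => exact List.Subset.trans (subset_push _ _ _ _) ih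
  | case3 => simp
  | case4 => simp
  | case5 => simp

/-- The last clause stays false under the trail throughout. If its largest literal is an assumption,
it is the clause that `Nice` asks for; otherwise that literal is resolved away, and the new clause
is false under a shorter trail. When the trail is used up the clause is empty. The trail refers to
`S`, while the list `S0` grows. -/
theorem nice_reduce {S S0 : List Entry} (hS : S ⊆ S0) {e u : List Code} {F : Trail}
    (hF : TrailOK S e F) (hu : fits u F = true) (hs : Has S0 (strip u)) :
    Nice (reduce S0 u F) e := by
  induction e generalizing S0 u F with
  | nil => cases F <;> cases u <;> simp_all [TrailOK, fits, Nice, reduce, strip]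
  | cons c e ih =>
    cases F with
    | nil => simp [TrailOK] at hF
    | cons f F =>
      obtain ⟨f1, f2⟩ := f
      cases u with
      | nil => simp [fits] at hu
      | cons a g =>
        simp only [fits, Bool.and_eq_true, Bool.or_eq_true, beq_iff_eq] at hu
        cases a with
        | none =>
          have hr : reduce S0 (none :: g) ((f1, f2) :: F) = reduce S0 g F := by simp only [reduce]
          rw [hr]
          exact .inl (ih hS hF.1 hu.2 hs)
        | some b =>
          cases f2 with
          | none =>
            have hr : reduce S0 (some b :: g) ((f1, none) :: F) = S0 := by simp only [reduce]
            rw [hr]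
            refine .inr ⟨b, g, ?_, hs, (hF.1.sub hu.2).mono hS⟩
            rcases hF.2 with ⟨h2, -⟩ | ⟨b, R, h2, -⟩
            · rw [← h2]; simpa [eq_comm] using hu.1
            · simp at h2
          | some R =>
            rcases hF.2 with ⟨-, h2⟩ | ⟨b', R', h2, h3, -⟩
            · simp at h2
            · simp only [Prod.mk.injEq, Option.some.injEq] at h2
              have hr : reduce S0 (some b :: g) ((f1, some R) :: F) =
                  reduce (push S0 (S0.length - 1) R.1 (merge g R.2)) (merge g R.2) F := by
                simp only [reduce]
              rw [hr]
              refine .inl (ih (List.Subset.trans hS (subset_push _ _ _ _)) hF.1 (fits_merge hu.2 ?_)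
                ⟨_, List.mem_cons_self, rfl⟩)
              rw [h2.2]; exact h3

/-- What a scan returns. -/
theorem scan_spec (S : List Entry) (e : List Code) :
    (∃ F, scan S e = (S, some F) ∧ TrailOK S e F ∧
      (Nice S e ∨ (¬ Clash S e ∧ ∀ r, Sub S e r → fits r F = true))) ∨
    ∃ e0 e' F R R', e = e0 ++ none :: e' ∧ TrailOK S e' F ∧
      search true F S = some R ∧ search false F S = some R' ∧
      scan S e = (reduce (push S R.1 R'.1 (merge R.2 R'.2)) (merge R.2 R'.2) F, none) := by
  induction e with
  | nil =>
    refine .inl ⟨[], rfl, trivial, .inr ⟨id, fun r hr => ?_⟩⟩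
    cases r <;> simp_all [Sub, fits]
  | cons c e ih =>
    have hsc : scan S (c :: e) = scanStep c (scan S e) := rfl
    rcases ih with ⟨F, h1, h2, h3⟩ | ⟨e0, e', F, R, R', rfl, h2, h3, h4, h5⟩
    · rw [h1] at hsc
      cases c with
      | some b =>
        refine .inl ⟨_, hsc, ⟨h2, .inl ⟨rfl, rfl⟩⟩, ?_⟩
        rcases h3 with h3 | ⟨h3, h4⟩
        · exact .inl (.inl h3)
        -- No search is made at an assumption. A derived clause that is false with largest literal
        -- `some b` there already witnesses `Nice`; without one, the trail remains complete.
        · by_cases hr : ∃ r, Has S (some b :: r) ∧ Sub S e r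
          · obtain ⟨r, h5, h6⟩ := hr
            exact .inl (.inr ⟨b, r, rfl, h5, h6⟩)
          · refine .inr ⟨?_, fun r h5 => ?_⟩
            · rintro (h5 | ⟨r, r', h5, h6, h7, h8⟩)
              · exact h3 h5
              · cases b
                · exact hr ⟨r', h7, h8⟩
                · exact hr ⟨r, h5, h6⟩
            · cases r with
              | nil => simp [Sub] at h5
              | cons a r =>
                simp only [fits, Bool.and_eq_true, Bool.or_eq_true, beq_iff_eq]
                refine ⟨?_, h4 _ h5.1⟩
                rcases h5.2 with h6 | h6 | ⟨b', r', h6, h7, h8⟩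
                · exact .inl h6
                · exact .inr h6
                · by_cases hb : b' = b
                  · exact .inr (by rw [h6, hb])
                  · have : (!b') = b := by cases b <;> cases b' <;> simp_all
                    rw [this] at h7
                    exact absurd ⟨r', h7, h8⟩ hr
      | none =>
        rcases ht : search true F S with _ | R <;> rcases hf : search false F S with _ | R'
        · simp only [scanStep, ht, hf] at hsc
          refine .inl ⟨_, hsc, ⟨h2, .inl ⟨rfl, rfl⟩⟩, h3.imp .inl fun ⟨h3, h4⟩ => ⟨?_, ?_⟩⟩
          · rintro (h5 | ⟨r, r', h5, h6, h7, h8⟩)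
            · exact h3 h5
            · exact not_fits_of_search ht h5 (h4 _ h6)
          · intro r h5
            cases r with
            | nil => simp [Sub] at h5
            | cons a r =>
              simp only [fits, Bool.and_eq_true, Bool.or_eq_true, beq_iff_eq]
              refine ⟨?_, h4 _ h5.1⟩
              rcases h5.2 with h6 | h6 | ⟨b, r', h6, h7, h8⟩
              · exact .inl h6
              · exact .inl h6
              · cases b
                · exact absurd (h4 _ h8) (not_fits_of_search ht h7)
                · exact absurd (h4 _ h8) (not_fits_of_search hf h7)
        · simp only [scanStep, ht, hf] at hsc
          obtain ⟨hR, hE⟩ := exists_of_search hf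
          refine .inl ⟨_, hsc, ⟨h2, .inr ⟨true, R', rfl, hR, hE⟩⟩,
            h3.imp .inl fun ⟨h3, h4⟩ => ⟨?_, ?_⟩⟩
          · rintro (h5 | ⟨r, r', h5, h6, h7, h8⟩)
            · exact h3 h5
            · exact not_fits_of_search ht h5 (h4 _ h6)
          · intro r h5
            cases r with
            | nil => simp [Sub] at h5
            | cons a r =>
              simp only [fits, Bool.and_eq_true, Bool.or_eq_true, beq_iff_eq]
              refine ⟨?_, h4 _ h5.1⟩
              rcases h5.2 with h6 | h6 | ⟨b, r', h6, h7, h8⟩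
              · exact .inl h6
              · exact .inl h6
              · cases b
                · exact absurd (h4 _ h8) (not_fits_of_search ht h7)
                · exact .inr h6
        · simp only [scanStep, ht, hf] at hsc
          obtain ⟨hR, hE⟩ := exists_of_search ht
          refine .inl ⟨_, hsc, ⟨h2, .inr ⟨false, R, rfl, hR, hE⟩⟩,
            h3.imp .inl fun ⟨h3, h4⟩ => ⟨?_, ?_⟩⟩
          · rintro (h5 | ⟨r, r', h5, h6, h7, h8⟩)
            · exact h3 h5
            · exact not_fits_of_search hf h7 (h4 _ h8)
          · intro r h5
            cases r with
            | nil => simp [Sub] at h5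
            | cons a r =>
              simp only [fits, Bool.and_eq_true, Bool.or_eq_true, beq_iff_eq]
              refine ⟨?_, h4 _ h5.1⟩
              rcases h5.2 with h6 | h6 | ⟨b, r', h6, h7, h8⟩
              · exact .inl h6
              · exact .inl h6
              · cases b
                · exact .inr h6
                · exact absurd (h4 _ h8) (not_fits_of_search hf h7)
        · simp only [scanStep, ht, hf] at hsc
          exact .inr ⟨[], e, F, R, R', rfl, h2, ht, hf, hsc⟩
    · rw [h5] at hsc
      exact .inr ⟨c :: e0, e', F, R, R', rfl, h2, h3, h4, hsc⟩

theorem subset_scan (S : List Entry) (e : List Code) : S ⊆ (scan S e).1 := by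
  rcases scan_spec S e with ⟨F, h1, -⟩ | ⟨e0, e', F, R, R', -, -, -, -, h5⟩
  · simp [h1]
  · rw [h5]
    exact List.Subset.trans (subset_push _ _ _ _) (subset_reduce _ _ _)

/-- A scan without conflict has a trail that excludes `Clash` unless `Nice` holds already; after a
conflict the reduction has produced the clause wanted. -/
theorem nice_scan {S : List Entry} {e : List Code} (h : Nice S e ∨ Clash S e) :
    Nice (scan S e).1 e := by
  rcases scan_spec S e with ⟨F, h1, h2, h3⟩ | ⟨e0, e', F, R, R', rfl, h2, h3, h4, h5⟩
  · rw [h1]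
    rcases h3 with h3 | h3
    · exact h3
    · exact h.resolve_right h3.1
  · rw [h5]
    exact Nice.append e0 (.inl (nice_reduce (subset_push _ _ _ _) h2
      (fits_merge (exists_of_search h3).1 (exists_of_search h4).1) ⟨_, List.mem_cons_self, rfl⟩))

/-! Lists as clauses. -/

/-- How the variable number `k`, in the order, occurs in the clause. -/
def codeAt : List Code → ℕ → Code
  | [], _ => none
  | a :: r, k => if k = r.length then a else codeAt r k

theorem codeAt_of_length_le {l : List Code} {k : ℕ} (h : l.length ≤ k) : codeAt l k = none := by
  induction l with
  | nil => rfl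
  | cons a r ih =>
    simp only [List.length_cons] at h
    rw [codeAt, if_neg (by omega), ih (by omega)]

theorem codeAt_strip (l : List Code) (k : ℕ) : codeAt (strip l) k = codeAt l k := by
  induction l with
  | nil => rfl
  | cons a r ih =>
    cases a with
    | none =>
      change codeAt (strip r) k = _
      rw [ih, codeAt]
      split_ifs with h
      · exact codeAt_of_length_le h.ge
      · rfl
    | some b => rfl

theorem length_merge {r g : List Code} (h : r.length = g.length) :
    (merge r g).length = r.length := by
  simp [merge, h]

theorem codeAt_merge {r g : List Code} (h : r.length = g.length) (k : ℕ) :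
    codeAt (merge r g) k = (codeAt r k).or (codeAt g k) := by
  induction r generalizing g with
  | nil => cases g <;> simp_all [merge, codeAt]
  | cons a r ih =>
    cases g with
    | nil => simp at h
    | cons c g =>
      have h' : r.length = g.length := by simpa using h
      change (if k = (merge r g).length then a.or c else codeAt (merge r g) k) = _
      rw [length_merge h', codeAt, codeAt, ← h', ih h']
      split_ifs <;> rfl

theorem codeAt_of_fits {r : List Code} {F : Trail} (h : fits r F = true) (k : ℕ) :
    codeAt r k = none ∨ codeAt r k = codeAt (F.map Prod.fst) k := by
  induction r generalizing F with
  | nil => exact .inl rfl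
  | cons a r ih =>
    cases F with
    | nil => simp [fits] at h
    | cons f F =>
      simp only [fits, Bool.and_eq_true, Bool.or_eq_true, beq_iff_eq] at h
      simp only [codeAt, List.map_cons, List.length_map, length_eq_of_fits h.2]
      split_ifs
      · exact h.1
      · exact ih h.2

theorem codeAt_append (f e : List Code) (k : ℕ) :
    codeAt (f ++ e) k = if k < e.length then codeAt e k else codeAt f (k - e.length) := by
  induction f with
  | nil =>
    split_ifs with h
    · rfl
    · exact codeAt_of_length_le (by simpa using h)
  | cons a f ih =>
    simp only [List.cons_append, codeAt, List.length_append, ih]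
    split_ifs <;> first | rfl | omega

theorem exists_split (l : List Code) {k : ℕ} (hk : k < l.length) :
    ∃ f e, l = f ++ codeAt l k :: e ∧ e.length = k := by
  induction l with
  | nil => simp at hk
  | cons a r ih =>
    rw [codeAt]
    split_ifs with h
    · exact ⟨[], r, rfl, h.symm⟩
    · obtain ⟨f, e, h1, h2⟩ := ih (by simp at hk; omega)
      refine ⟨a :: f, e, ?_, h2⟩
      rw [List.cons_append, ← h1]

theorem le_of_codeAt {l m : List Code} (h : l.length = m.length)
    (hc : ∀ k < l.length, codeAt l k = none ∨ codeAt l k = codeAt m k) : Le l m := by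
  induction l generalizing m with
  | nil => cases m <;> simp_all
  | cons a l ih =>
    cases m with
    | nil => simp at h
    | cons c m =>
      have h' : l.length = m.length := by simpa using h
      refine .cons ?_ (ih h' fun k hk => ?_)
      · simpa [codeAt, h'] using hc l.length (by simp)
      · have := hc k (by simp; omega)
        rwa [codeAt, codeAt, if_neg (by omega), if_neg (by omega)] at this

theorem eq_replicate_of_codeAt {l : List Code} (hc : ∀ k < l.length, codeAt l k = none) :
    l = List.replicate l.length none := by
  induction l with
  | nil => rfl
  | cons a l ih =>
    rw [List.length_cons, List.replicate_succ, ← ih fun k hk => ?_]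
    · have := hc l.length (by simp)
      rw [codeAt, if_pos rfl] at this
      rw [this]
    · have := hc k (by simp; omega)
      rwa [codeAt, if_neg (by omega)] at this

theorem sub_refl (S : List Entry) (e : List Code) : Sub S e e := by
  induction e with
  | nil => trivial
  | cons c e ih => exact ⟨ih, .inr (.inl rfl)⟩

theorem nice_of_has_strip {S : List Entry} {e : List Code} (h : Has S (strip e)) : Nice S e := by
  induction e with
  | nil => exact h
  | cons c e ih =>
    cases c with
    | none => exact .inl (ih h)
    | some b => exact .inr ⟨b, e, rfl, h, sub_refl S e⟩

variable {n : ℕ}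

/-- How a variable occurs in a clause. -/
def code (C : Clause n) (i : Fin n) : Code :=
  if (i, true) ∈ C.lits then some true else if (i, false) ∈ C.lits then some false else none

theorem code_eq_some {C : Clause n} {i : Fin n} {b : Bool} :
    code C i = some b ↔ (i, b) ∈ C.lits := by
  have := C.consistent i
  unfold code
  cases b <;> split_ifs <;> simp_all

/-- The clause given by a list. -/
def clauseOf (π : Equiv.Perm (Fin n)) (cl : List Code) : Clause n where
  lits := Finset.univ.filter fun l => codeAt cl (π l.1) = some l.2
  consistent i := by simp; intro h; simp [h]

theorem mem_clauseOf {π : Equiv.Perm (Fin n)} {cl : List Code} {l : Lit n} :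
    l ∈ (clauseOf π cl).lits ↔ codeAt cl (π l.1) = some l.2 := by
  simp [clauseOf]

theorem code_clauseOf (π : Equiv.Perm (Fin n)) (cl : List Code) (i : Fin n) :
    code (clauseOf π cl) i = codeAt cl (π i) := by
  refine Option.ext fun b => ?_
  rw [code_eq_some, mem_clauseOf]

theorem clauseOf_strip (π : Equiv.Perm (Fin n)) (u : List Code) :
    clauseOf π (strip u) = clauseOf π u := by
  ext l
  rw [mem_clauseOf, mem_clauseOf, codeAt_strip]

/-- The list `e` represents the clause `C`. -/
def Represents (π : Equiv.Perm (Fin n)) (e : List Code) (C : Clause n) : Prop :=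
  e.length = n ∧ ∀ i, codeAt e (π i) = code C i

theorem Represents.clauseOf_eq {π : Equiv.Perm (Fin n)} {e : List Code} {C : Clause n}
    (h : Represents π e C) : clauseOf π e = C := by
  ext l
  rw [mem_clauseOf, h.2, code_eq_some]

/-- Being false under one trail, `r` and `g` contain no complementary literals, so `merge` is their
union and no tautology. Their variables have positions below `F.length`, the position of the
resolved variable. -/
theorem infers_clauseOf (π : Equiv.Perm (Fin n)) {r g : List Code} {F : Trail}
    (hr : fits r F = true) (hg : fits g F = true) (hn : F.length < n) (b : Bool) :
    Infers ordered π (clauseOf π (some b :: r)) (clauseOf π (some (!b) :: g))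
      (clauseOf π (merge r g)) := by
  have hlr := length_eq_of_fits hr
  have hlg := length_eq_of_fits hg
  set i := π.symm ⟨F.length, hn⟩ with hi
  have hπ : ((π i : Fin n) : ℕ) = F.length := by simp [hi]
  have key : ∀ (c : Bool) (q : List Code), q.length = F.length → ∀ l : Lit n,
      l ∈ (clauseOf π (some c :: q)).lits.erase (i, c) ↔ codeAt q (π l.1) = some l.2 := by
    intro c q hq l
    rw [Finset.mem_erase, mem_clauseOf, codeAt, hq]
    split_ifs with h
    · have hli : l.1 = i := π.injective (Fin.ext (h.trans hπ.symm))
      rw [codeAt_of_length_le (by omega)]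
      simp only [reduceCtorEq, iff_false]
      rintro ⟨h1, h2⟩
      exact h1 (Prod.ext hli (Option.some.inj h2).symm)
    · refine ⟨fun h1 => h1.2, fun h1 => ⟨?_, h1⟩⟩
      rintro rfl
      exact h hπ
  have hlt : ∀ (q : List Code), q.length = F.length → ∀ l : Lit n,
      codeAt q (π l.1) = some l.2 → π l.1 < π i := by
    intro q hq l h
    by_contra h1
    rw [codeAt_of_length_le (by rw [hq, ← hπ]; simpa using h1)] at h
    cases h
  refine ⟨i, b, ?_, ?_, ?_, ?_⟩
  · rw [mem_clauseOf, codeAt, if_pos (hπ.trans hlr.symm)]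
  · rw [mem_clauseOf, codeAt, if_pos (hπ.trans hlg.symm)]
  · intro l hl
    rcases Finset.mem_union.1 hl with hl | hl
    · exact hlt r hlr l ((key _ r hlr l).1 hl)
    · exact hlt g hlg l ((key _ g hlg l).1 hl)
  · ext l
    rw [Finset.mem_union, key _ r hlr, key _ g hlg, mem_clauseOf,
      codeAt_merge (hlr.trans hlg.symm)]
    rcases codeAt_of_fits hr (π l.1) with h1 | h1 <;> rcases codeAt_of_fits hg (π l.1) with h2 | h2
    · simp [h1, h2]
    · simp [h1]
    · simp [h2]
    · rw [h1, h2]; simp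

/-- A half-ordered inference, seen by the propagation. -/
theorem nice_or_clash_of_infers {π : Equiv.Perm (Fin n)} {S : List Entry} {C D G : Clause n}
    {e f g : List Code} (he : Represents π e C) (hf : Represents π f D) (hg : Represents π g G)
    (h : Infers halfOrdered π C D G) (h1 : Nice S e) (h2 : Nice S f) :
    Nice S g ∨ Clash S g := by
  obtain ⟨i, a, hC, hD, hS, hG⟩ := h
  -- By symmetry it suffices to treat the case that the resolved variable is the largest one of the
  -- first antecedent.
  have key : ∀ (a : Bool) (C D : Clause n) (e f : List Code), Represents π e C →
      Represents π f D → Nice S e → Nice S f → (i, a) ∈ C.lits → (i, !a) ∈ D.lits →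
      (∀ l ∈ C.lits.erase (i, a), π l.1 < π i) →
      G.lits = C.lits.erase (i, a) ∪ D.lits.erase (i, !a) → Nice S g ∨ Clash S g := by
    intro a C D e f he hf h1 h2 hC hD hS hG
    have hk : ((π i : Fin n) : ℕ) < n := (π i).2
    obtain ⟨e0, e1, hee, hel⟩ := exists_split e (hk.trans_eq he.1.symm)
    obtain ⟨f0, f1, hff, hfl⟩ := exists_split f (hk.trans_eq hf.1.symm)
    obtain ⟨g0, g1, hgg, hgl⟩ := exists_split g (hk.trans_eq hg.1.symm)
    have hen := he.1
    have hfn := hf.1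
    have hgn := hg.1
    rw [hee] at hen
    rw [hff] at hfn
    rw [hgg] at hgn
    simp only [List.length_append, List.length_cons] at hen hfn hgn
    have hlow : ∀ {q q0 q1 : List Code} {c : Code}, q = q0 ++ c :: q1 →
        q1.length = (π i : ℕ) → ∀ j < (π i : ℕ), codeAt q1 j = codeAt q j := by
      intro q q0 q1 c hq hl j hj
      rw [hq, codeAt_append, if_pos (by simp; omega), codeAt, if_neg (by omega)]
    have hhigh : ∀ {q q0 q1 : List Code} {c : Code}, q = q0 ++ c :: q1 →
        q1.length = (π i : ℕ) → ∀ j, codeAt q0 j = codeAt q (j + (π i : ℕ) + 1) := by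
      intro q q0 q1 c hq hl j
      rw [hq, codeAt_append, if_neg (by simp; omega)]
      congr 1
      simp; omega
    -- Away from the resolved variable, an antecedent is included in the resolvent.
    have hle : ∀ (b : Bool) (D : Clause n) (q : List Code), Represents π q D →
        D.lits.erase (i, b) ⊆ G.lits → (i, b) ∈ D.lits → ∀ j < n, j ≠ (π i : ℕ) →
        codeAt q j = none ∨ codeAt q j = codeAt g j := by
      intro b D q hq hsub hb j hj hji
      have hj' : j = (π (π.symm ⟨j, hj⟩) : ℕ) := by simp
      rw [hj', hq.2, hg.2]
      rcases hc : code D (π.symm ⟨j, hj⟩) with _ | b'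
      · exact .inl rfl
      · refine .inr (Eq.symm (code_eq_some.2 (hsub (Finset.mem_erase.2 ⟨?_, code_eq_some.1 hc⟩))))
        intro h
        apply hji
        have h4 := congrArg (fun x : Fin n => ((π x : Fin n) : ℕ)) (Prod.ext_iff.1 h).1
        simpa using h4
    have hle1 := hle a C e he (hG ▸ Finset.subset_union_left) hC
    have hle2 := hle _ D f hf (hG ▸ Finset.subset_union_right) hD
    rw [he.2 i, code_eq_some.2 hC] at hee
    rw [hf.2 i, code_eq_some.2 hD] at hff
    -- This is the use of the order: nothing occurs above the resolved variable.
    have he0 : e0 = List.replicate e0.length none := by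
      refine eq_replicate_of_codeAt fun k hk => ?_
      rw [hhigh hee hel]
      have hj : k + (π i : ℕ) + 1 < n := by omega
      have hj' : k + (π i : ℕ) + 1 = (π (π.symm ⟨_, hj⟩) : ℕ) := by simp
      rw [hj', he.2]
      rcases hc : code C (π.symm ⟨_, hj⟩) with _ | b'
      · rfl
      · have h3 := hS _ (Finset.mem_erase.2 ⟨fun h => ?_, code_eq_some.1 hc⟩)
        · simp only [Equiv.apply_symm_apply, Fin.lt_def] at h3
          omega
        · have h4 := congrArg (fun x : Fin n => ((π x : Fin n) : ℕ)) (Prod.ext_iff.1 h).1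
          simp only [Equiv.apply_symm_apply] at h4
          omega
    rw [hee, he0] at h1
    rw [hff] at h2
    rw [hgg]
    refine nice_or_clash e0.length (le_of_codeAt (by omega) fun k hk => ?_)
      (le_of_codeAt (by omega) fun k hk => ?_) (le_of_codeAt (by omega) fun k hk => ?_) h1 h2
    · rw [hlow hee hel k (by omega), hlow hgg hgl k (by omega)]
      exact hle1 k (by omega) (by omega)
    · rw [hlow hff hfl k (by omega), hlow hgg hgl k (by omega)]
      exact hle2 k (by omega) (by omega)
    · rw [hhigh hff hfl, hhigh hgg hgl]
      exact hle2 _ (by omega) (by omega)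
  rcases hS with hS | hS
  · exact key a C D e f he hf h1 h2 hC hD hS hG
  · refine key (!a) D C f e hf he h2 h1 hD (by simpa using hC) hS ?_
    rw [hG, Finset.union_comm, Bool.not_not]

/-! Soundness and number of the derived lines. -/

/-- The line is correctly derived from earlier lines. -/
def EntryOK (π : Equiv.Perm (Fin n)) (τ : Set (Clause n)) (S : List Entry) (cl : List Code) :
    Just → Prop
  | Just.ax => clauseOf π cl ∈ τ
  | Just.res j k => ∃ A ∈ S, ∃ B ∈ S, A.1 = j ∧ B.1 = k ∧
      Infers ordered π (clauseOf π A.2.1) (clauseOf π B.2.1) (clauseOf π cl)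

/-- The lines, from the last to the first one, are an ordered resolution proof. -/
def Valid (π : Equiv.Perm (Fin n)) (τ : Set (Clause n)) : List Entry → Prop
  | [] => True
  | E :: S => Valid π τ S ∧ E.1 = S.length ∧ E.2.1.length ≤ n ∧ EntryOK π τ S E.2.1 E.2.2

/-- The lengths of the derived clauses, that is, the positions of their largest literals. -/
def tops (S : List Entry) : Finset ℕ := (S.map fun E => E.2.1.length).toFinset

/-- The number of variables in the trail that are not assumptions. -/
def reasons (F : Trail) : ℕ := F.countP fun f => f.2.isSome

theorem length_strip_le (u : List Code) : (strip u).length ≤ u.length :=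
  (List.dropWhile_sublist _).length_le

theorem reasons_le_length (F : Trail) : reasons F ≤ F.length := List.countP_le_length

theorem mem_tops {S : List Entry} {E : Entry} (h : E ∈ S) : E.2.1.length ∈ tops S := by
  simp only [tops, List.mem_toFinset, List.mem_map]
  exact ⟨E, h, rfl⟩

theorem tops_cons (E : Entry) (S : List Entry) :
    tops (E :: S) = insert E.2.1.length (tops S) := by
  simp [tops]

/-- The reason for the variable at position `k` is a derived clause of length `k + 1`, so distinct
propagated variables give distinct elements of `tops S`. -/
theorem TrailOK.reasons_le {S : List Entry} {e : List Code} {F : Trail} (h : TrailOK S e F) :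
    reasons F ≤ ((tops S).filter (· ≤ F.length)).card := by
  induction e generalizing F with
  | nil => cases F <;> simp_all [TrailOK, reasons]
  | cons c e ih =>
    cases F with
    | nil => simp [reasons]
    | cons f F =>
      have h1 := ih h.1
      rcases h.2 with ⟨-, h2⟩ | ⟨b, R, h2, h3, E, hE, -, h4⟩
      · have : reasons (f :: F) = reasons F := by simp [reasons, h2]
        rw [this]
        refine h1.trans (Finset.card_le_card fun k hk => ?_)
        simp only [Finset.mem_filter, List.length_cons] at hk ⊢
        exact ⟨hk.1, by omega⟩
      · have h5 : reasons (f :: F) = reasons F + 1 := by simp [reasons, h2]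
        have h6 : F.length + 1 ∈ tops S := by
          have := mem_tops hE
          rwa [h4, List.length_cons, length_eq_of_fits h3] at this
        rw [h5]
        calc reasons F + 1 ≤ ((tops S).filter (· ≤ F.length)).card + 1 := by omega
          _ = (insert (F.length + 1) ((tops S).filter (· ≤ F.length))).card := by
              rw [Finset.card_insert_of_notMem]; simp
          _ ≤ _ := by
              refine Finset.card_le_card fun k hk => ?_
              simp only [Finset.mem_insert, Finset.mem_filter, List.length_cons] at hk ⊢
              rcases hk with rfl | hk
              · exact ⟨h6, le_rfl⟩
              · exact ⟨hk.1, by omega⟩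

/-- Every resolution step uses up one propagated variable, which bounds their number. A clause that
is resolved further has the same largest variable as the reason used, so only the final clause can
contribute a new element `m` of `tops`. -/
theorem reduce_spec {π : Equiv.Perm (Fin n)} {τ : Set (Clause n)} {S S1 : List Entry}
    (hS : S ⊆ S1) {e u : List Code} {F : Trail} (hF : TrailOK S e F) (hn : F.length ≤ n)
    (hu : fits u F = true) (j k : ℕ) :
    (reduce (push S1 j k u) u F).length ≤ S1.length + 1 + reasons F ∧
    (∃ m, tops (reduce (push S1 j k u) u F) ⊆ insert m (tops S1)) ∧
    (Valid π τ (push S1 j k u) → Valid π τ (reduce (push S1 j k u) u F)) := by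
  induction e generalizing S1 u F j k with
  | nil =>
    cases F <;> cases u <;> simp_all [TrailOK, fits, reduce, push, tops_cons]
    exact ⟨_, subset_rfl⟩
  | cons c e ih =>
    cases F with
    | nil => simp [TrailOK] at hF
    | cons f F =>
      obtain ⟨f1, f2⟩ := f
      cases u with
      | nil => simp [fits] at hu
      | cons a g =>
        simp only [fits, Bool.and_eq_true, Bool.or_eq_true, beq_iff_eq] at hu
        rw [List.length_cons] at hn
        cases a with
        | none =>
          -- `push` strips the clause, so a leading `none` makes no difference.
          have hr : reduce (push S1 j k (none :: g)) (none :: g) ((f1, f2) :: F) =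
              reduce (push S1 j k g) g F := by
            simp only [reduce]; rfl
          rw [hr]
          obtain ⟨h1, h2, h3⟩ := ih hS hF.1 (by omega) hu.2 j k
          refine ⟨h1.trans ?_, h2, h3⟩
          simp [reasons, List.countP_cons]
        | some b =>
          cases f2 with
          | none =>
            simp only [reduce]
            exact ⟨by simp [push], ⟨_, (tops_cons _ _).subset⟩, fun h => h⟩
          | some R =>
            rcases hF.2 with ⟨-, h2⟩ | ⟨b', R', h2, h3, E, hE, h4, h5⟩
            · simp at h2
            · simp only [Prod.mk.injEq, Option.some.injEq] at h2
              obtain ⟨rfl, rfl⟩ := h2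
              obtain rfl : b = b' := by simpa using hu.1
              have hlen := length_eq_of_fits h3
              have hlen' := length_eq_of_fits hu.2
              simp only [reduce]
              obtain ⟨h6, ⟨m, h7⟩, h8⟩ :=
                ih (List.Subset.trans hS (subset_push S1 j k (some b :: g)))
                hF.1 (by omega) (fits_merge hu.2 h3) ((push S1 j k (some b :: g)).length - 1) R.1
              refine ⟨h6.trans ?_, ⟨m, h7.trans ?_⟩, fun hv => h8 ?_⟩
              · simp [push, reasons]; omega
              · refine Finset.insert_subset_insert _ ?_
                rw [push, tops_cons]
                -- The clause about to be resolved is as long as its reason, which belongs to `S`.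
                refine Finset.insert_subset ?_ subset_rfl
                have := mem_tops (hS hE)
                rw [h5, List.length_cons, hlen, ← hlen'] at this
                exact this
              · refine ⟨hv, rfl, ?_, ?_⟩
                · refine (length_strip_le _).trans ?_
                  rw [length_merge (hlen'.trans hlen.symm)]
                  omega
                · refine ⟨_, List.mem_cons_self, E, List.mem_cons_of_mem _ (hS hE),
                    ?_, h4, ?_⟩
                  · simp [push]
                  · rw [clauseOf_strip, clauseOf_strip, h5]
                    exact infers_clauseOf π hu.2 h3 (by omega) b

/-- The conflict variable is not on the trail, so `F.length + 1 ≤ n`, and the step for the conflict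
together with the reduction costs at most `n` lines. -/
theorem scan_bounds {π : Equiv.Perm (Fin n)} {τ : Set (Clause n)} {S : List Entry}
    {e : List Code} (he : e.length = n) (hv : Valid π τ S) :
    (scan S e).1.length ≤ S.length + n ∧ (scan S e).1.length ≤ S.length + (tops S).card ∧
    (tops (scan S e).1).card ≤ (tops S).card + 1 ∧ Valid π τ (scan S e).1 := by
  rcases scan_spec S e with ⟨F, h1, -⟩ | ⟨e0, e', F, R, R', rfl, h2, h3, h4, h5⟩
  · simp [h1, hv]
  · obtain ⟨h6, E, hE, h7, h8⟩ := exists_of_search h3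
    obtain ⟨h9, E', hE', h10, h11⟩ := exists_of_search h4
    have hl := h2.length_eq
    simp only [List.length_append, List.length_cons] at he
    have hr := length_eq_of_fits h6
    have hr' := length_eq_of_fits h9
    obtain ⟨k1, ⟨m, k2⟩, k3⟩ := reduce_spec (π := π) (τ := τ) (List.Subset.refl S) h2 (by omega)
      (fits_merge h6 h9) R.1 R'.1
    rw [h5]
    refine ⟨?_, ?_, ?_, k3 ⟨hv, rfl, ?_, ?_⟩⟩
    · have := reasons_le_length F
      refine k1.trans ?_
      omega
    · refine k1.trans ?_
      have k4 := h2.reasons_le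
      -- The two clauses in conflict have length `F.length + 1`, an element of `tops S` that belongs
      -- to no variable of the trail. It pays for the resolution of the conflict.
      have k5 : ((tops S).filter (· ≤ F.length)).card < (tops S).card := by
        refine Finset.card_lt_card (Finset.filter_ssubset.2 ⟨F.length + 1, ?_, by omega⟩)
        have := mem_tops hE
        rwa [h8, List.length_cons, hr] at this
      omega
    · exact (Finset.card_le_card k2).trans (Finset.card_insert_le _ _)
    · refine (length_strip_le _).trans ?_
      rw [length_merge (hr.trans hr'.symm)]
      omega
    · refine ⟨E, hE, E', hE', h7, h10, ?_⟩
      rw [clauseOf_strip, h8, h11]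
      exact infers_clauseOf π h6 h9 (by omega) true

/-! The whole simulation. -/

/-- The positions, from the last to the first one. -/
def positions (p : List ℕ) : List ℕ := (List.range p.length).reverse

/-- A clause whose variables are sorted from the last to the first position, where `p` is the
list of the positions of the variables. -/
def sorted (p : List ℕ) (c : List Code) : List Code :=
  (positions p).map fun k => (p.zip c).findSome? fun x => bif x.1 == k then x.2 else none

def unsorted (p : List ℕ) (cl : List Code) : List Code := p.map fun k => codeAt cl k

/-- Process a line of the half-ordered refutation. -/
def process (p : List ℕ) (S : List Entry) (L : List Code × Just) : List Entry :=
  match L.2 with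
  | Just.ax => (S.length, strip (sorted p L.1), Just.ax) :: S
  -- The antecedents are not looked up: the scan finds the conflict from the clause alone.
  | Just.res _ _ => (scan S (sorted p L.1)).1

def processAll (p : List ℕ) (G : List (List Code × Just)) : List Entry := G.foldl (process p) []

def simulate (p : List ℕ) (G : List (List Code × Just)) : List (List Code × Just) :=
  (processAll p G).reverse.map fun E => (unsorted p E.2.1, E.2.2)

/-- The raw lists have the same data as `encPerm`, `encClause` and `encLine`, so passing to them
costs no time. -/
def rawPerm (π : Equiv.Perm (Fin n)) : List ℕ := List.ofFn fun i => (π i : ℕ)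

def rawClause (C : Clause n) : List Code := List.ofFn (code C)

def rawLine (L : Line n) : List Code × Just := (rawClause L.clause, L.just)

theorem codeAt_map_range_reverse (f : ℕ → Code) {m k : ℕ} (hk : k < m) :
    codeAt ((List.range m).reverse.map f) k = f k := by
  induction m with
  | zero => omega
  | succ m ih =>
    simp only [List.range_succ, List.reverse_append, List.reverse_singleton, List.singleton_append,
      List.map_cons, codeAt, List.length_map, List.length_reverse, List.length_range]
    split_ifs with h
    · rw [h]
    · exact ih (by omega)

theorem mem_zip_raw {π : Equiv.Perm (Fin n)} {C : Clause n} {x : ℕ × Code} :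
    x ∈ (rawPerm π).zip (rawClause C) ↔ ∃ i, x = ((π i : ℕ), code C i) := by
  rw [List.mem_iff_getElem]
  simp only [rawPerm, rawClause, List.getElem_zip, List.getElem_ofFn, List.length_zip,
    List.length_ofFn, min_self]
  constructor
  · rintro ⟨i, hi, rfl⟩
    exact ⟨⟨i, hi⟩, rfl⟩
  · rintro ⟨i, rfl⟩
    exact ⟨i, i.2, rfl⟩

theorem represents_sorted (π : Equiv.Perm (Fin n)) (C : Clause n) :
    Represents π (sorted (rawPerm π) (rawClause C)) C := by
  refine ⟨by simp [sorted, positions, rawPerm], fun i => ?_⟩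
  rw [sorted, positions, codeAt_map_range_reverse _ (by simp [rawPerm])]
  rcases h : List.findSome? _ _ with _ | b
  · have := List.findSome?_eq_none_iff.1 h _ (mem_zip_raw.2 ⟨i, rfl⟩)
    simpa using this.symm
  · obtain ⟨x, hx, h1⟩ := List.exists_of_findSome?_eq_some h
    obtain ⟨j, rfl⟩ := mem_zip_raw.1 hx
    by_cases hji : (π j : ℕ) = π i
    · have : j = i := π.injective (Fin.ext hji)
      simpa [this] using h1.symm
    · simp [beq_eq_false_iff_ne.2 hji] at h1

theorem unsorted_rawPerm (π : Equiv.Perm (Fin n)) (cl : List Code) :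
    unsorted (rawPerm π) cl = rawClause (clauseOf π cl) := by
  simp only [unsorted, rawPerm, rawClause, List.map_ofFn]
  congr 1
  funext i
  exact (code_clauseOf π cl i).symm

/-! ### From the derived lines to an ordered refutation -/

/-- The derived lines as a proof. -/
def toProof (π : Equiv.Perm (Fin n)) (S : List Entry) : Proof n :=
  S.reverse.map fun E => ⟨clauseOf π E.2.1, E.2.2⟩

theorem toProof_cons (π : Equiv.Perm (Fin n)) (E : Entry) (S : List Entry) :
    toProof π (E :: S) = toProof π S ++ [⟨clauseOf π E.2.1, E.2.2⟩] := by
  simp [toProof]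

theorem length_toProof (π : Equiv.Perm (Fin n)) (S : List Entry) :
    (toProof π S).length = S.length := by
  simp [toProof]

theorem getElem?_toProof {π : Equiv.Perm (Fin n)} {τ : Set (Clause n)} {S : List Entry}
    (hv : Valid π τ S) {A : Entry} (hA : A ∈ S) :
    (toProof π S)[A.1]? = some ⟨clauseOf π A.2.1, A.2.2⟩ := by
  induction S with
  | nil => simp at hA
  | cons E S ih =>
    rw [toProof_cons]
    rcases List.mem_cons.1 hA with rfl | hA
    · rw [hv.2.1, List.getElem?_append_right (length_toProof π S).le, length_toProof]
      simp
    · have h := ih hv.1 hA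
      rw [List.getElem?_append_left (List.getElem?_eq_some_iff.1 h).1, h]

theorem lineOK_append {S : System} {π : Equiv.Perm (Fin n)} {τ : Set (Clause n)} {P : Proof n}
    (Q : Proof n) {t : ℕ} {L : Line n} (h : LineOK S π τ P t L) :
    LineOK S π τ (P ++ Q) t L := by
  unfold LineOK at h ⊢
  split at h
  · exact h
  · obtain ⟨hj, hk, A, B, hA, hB, hi⟩ := h
    refine ⟨hj, hk, A, B, ?_, ?_, hi⟩
    · rw [List.getElem?_append_left (List.getElem?_eq_some_iff.1 hA).1, hA]
    · rw [List.getElem?_append_left (List.getElem?_eq_some_iff.1 hB).1, hB]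

theorem isProof_toProof {π : Equiv.Perm (Fin n)} {τ : Set (Clause n)} {S : List Entry}
    (hv : Valid π τ S) : IsProof ordered π τ (toProof π S) := by
  induction S with
  | nil => intro t L h; simp [toProof] at h
  | cons E S ih =>
    intro t L h
    rw [toProof_cons] at h ⊢
    rcases lt_or_ge t (toProof π S).length with ht | ht
    · rw [List.getElem?_append_left ht] at h
      exact lineOK_append _ (ih hv.1 t L h)
    · refine lineOK_append _ ?_
      rw [List.getElem?_append_right ht, List.getElem?_singleton] at h
      split_ifs at h with ht'
      obtain rfl := Option.some.inj h
      obtain rfl : t = (toProof π S).length := by omega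
      have hE := hv.2.2.2
      unfold LineOK
      rcases hJ : E.2.2 with _ | ⟨j, k⟩ <;> simp only [hJ] at hE ⊢
      · exact hE
      · obtain ⟨A, hA, B, hB, rfl, rfl, hi⟩ := hE
        have h1 := getElem?_toProof hv.1 hA
        have h2 := getElem?_toProof hv.1 hB
        exact ⟨(List.getElem?_eq_some_iff.1 h1).1, (List.getElem?_eq_some_iff.1 h2).1, _, _,
          h1, h2, hi⟩

theorem processAll_concat (p : List ℕ) (G : List (List Code × Just)) (L : List Code × Just) :
    processAll p (G ++ [L]) = process p (processAll p G) L := by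
  simp [processAll]

/-- What is known after some lines of the half-ordered refutation have been processed. -/
theorem processAll_take {π : Equiv.Perm (Fin n)} {τ : Set (Clause n)} {Γ : Proof n}
    (hΓ : IsProof halfOrdered π τ Γ) (t : ℕ) (ht : t ≤ Γ.length) :
    let S := processAll (rawPerm π) ((Γ.take t).map rawLine)
    Valid π τ S ∧ (1 ≤ n → S.length ≤ n * t) ∧ S.length ≤ t * t ∧ (tops S).card ≤ t ∧
    ∀ i < t, ∀ L, Γ[i]? = some L → Nice S (sorted (rawPerm π) (rawClause L.clause)) := by
  induction t with
  | zero => simp [processAll, Valid, tops]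
  | succ t ih =>
    obtain ⟨h1, h2, h3, h4, h5⟩ := ih (by omega)
    rw [List.take_succ_eq_append_getElem (by omega), List.map_append, List.map_singleton,
      processAll_concat]
    have hget : Γ[t]? = some Γ[t] := List.getElem?_eq_getElem (by omega)
    have hok := hΓ t _ hget
    generalize hS : processAll (rawPerm π) ((Γ.take t).map rawLine) = S at h1 h2 h3 h4 h5 ⊢
    generalize hL : Γ[t] = L at hok hget ⊢
    have hrep := represents_sorted π L.clause
    have hsub : S ⊆ process (rawPerm π) S (rawLine L) := by
      unfold process
      split
      · exact List.subset_cons_self _ _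
      · exact subset_scan _ _
    have hnice : Nice (process (rawPerm π) S (rawLine L))
        (sorted (rawPerm π) (rawClause L.clause)) →
        ∀ i < t + 1, ∀ L', Γ[i]? = some L' → Nice (process (rawPerm π) S (rawLine L))
          (sorted (rawPerm π) (rawClause L'.clause)) := by
      intro h i hi L' hL'
      rcases Nat.lt_succ_iff_lt_or_eq.1 hi with hi | rfl
      · exact (h5 i hi L' hL').mono hsub
      · rw [hget] at hL'
        rwa [← Option.some.inj hL']
    obtain ⟨C, J⟩ := L
    replace hrep : Represents π (sorted (rawPerm π) (rawClause C)) C := hrep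
    unfold LineOK at hok
    cases J with
    | ax =>
      have hp : process (rawPerm π) S (rawLine ⟨C, Just.ax⟩) =
        (S.length, strip (sorted (rawPerm π) (rawClause C)), Just.ax) :: S := rfl
      refine ⟨?_, fun hn => ?_, ?_, ?_, hnice ?_⟩
      · rw [hp]
        refine ⟨h1, rfl, (length_strip_le _).trans hrep.1.le, ?_⟩
        change clauseOf π (strip (sorted (rawPerm π) (rawClause C))) ∈ τ
        rw [clauseOf_strip, hrep.clauseOf_eq]
        exact hok
      -- An axiom costs one line, which is at most `n` because `1 ≤ n`.
      · rw [hp, List.length_cons, Nat.mul_succ]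
        have := h2 hn
        omega
      · rw [hp, List.length_cons]
        nlinarith
      · rw [hp, tops_cons]
        exact (Finset.card_insert_le _ _).trans (by omega)
      · rw [hp]
        exact nice_of_has_strip ⟨_, List.mem_cons_self, rfl⟩
    | res j k =>
      have hp : process (rawPerm π) S (rawLine ⟨C, Just.res j k⟩) =
        (scan S (sorted (rawPerm π) (rawClause C))).1 := rfl
      obtain ⟨hj, hk, A, B, hA, hB, hi⟩ := hok
      obtain ⟨k1, k2, k3, k4⟩ := scan_bounds hrep.1 h1
      refine ⟨?_, fun hn => ?_, ?_, ?_, hnice ?_⟩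
      · rw [hp]
        exact k4
      · rw [hp, Nat.mul_succ]
        have := h2 hn
        omega
      · rw [hp]
        -- At most `(tops S).card ≤ t` lines are new, and `t * t + t ≤ (t + 1) * (t + 1)`.
        nlinarith
      · rw [hp]
        omega
      · rw [hp]
        exact nice_scan (nice_or_clash_of_infers (represents_sorted π A.clause)
          (represents_sorted π B.clause) hrep hi (h5 j hj A hA) (h5 k hk B hB))

theorem processAll_spec {π : Equiv.Perm (Fin n)} {τ : Set (Clause n)} {Γ : Proof n}
    (hΓ : Refutes halfOrdered π τ Γ) :
    let Δ := toProof π (processAll (rawPerm π) (Γ.map rawLine))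
    Refutes ordered π τ Δ ∧ (1 ≤ n → Δ.length ≤ n * Γ.length) ∧
      Δ.length ≤ Γ.length * Γ.length := by
  obtain ⟨h1, h2, h3, h4, h5⟩ := processAll_take hΓ.1 Γ.length le_rfl
  rw [List.take_length] at h1 h2 h3 h4 h5
  obtain ⟨L, hL, hLe⟩ := hΓ.2
  obtain ⟨i, hi, rfl⟩ := List.mem_iff_getElem.1 hL
  have hn := h5 i hi _ (List.getElem?_eq_getElem hi)
  have hrep := represents_sorted π Γ[i].clause
  have hrepl := eq_replicate_of_codeAt (l := sorted (rawPerm π) (rawClause Γ[i].clause))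
    fun k hk => by
      rw [hrep.1] at hk
      have hk' : k = (π (π.symm ⟨k, hk⟩) : ℕ) := by simp
      rw [hk', hrep.2]
      rcases hc : code Γ[i].clause (π.symm ⟨k, hk⟩) with _ | b
      · rfl
      · have := code_eq_some.1 hc
        simp [hLe] at this
  -- The list of the empty clause consists of `none` only, so `Nice` goes down to `Nice S []`: the
  -- empty clause has been derived.
  rw [hrepl, ← List.append_nil (List.replicate _ _)] at hn
  obtain ⟨E, hE, hE0⟩ := nice_replicate_none _ hn
  refine ⟨⟨isProof_toProof h1, ⟨clauseOf π E.2.1, E.2.2⟩, ?_, ?_⟩, ?_, ?_⟩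
  · simp only [toProof, List.mem_map, List.mem_reverse]
    exact ⟨E, hE, rfl⟩
  · ext l
    simp [mem_clauseOf, hE0, codeAt]
  · rwa [length_toProof]
  · rwa [length_toProof]

/-! ### Agreement with the encodings in the statement -/

theorem enc_code (C : Clause n) (i : Fin n) : Enc.enc (code C i) =
    if (i, true) ∈ C.lits then encNat 1
    else if (i, false) ∈ C.lits then encNat 2 else encNat 0 := by
  unfold code
  split_ifs <;> rfl

theorem enc_rawPerm (π : Equiv.Perm (Fin n)) : Enc.enc (rawPerm π) = encPerm π := by
  simp only [Enc.enc, rawPerm, encPerm, List.map_ofFn]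
  rfl

theorem enc_rawClause (C : Clause n) : Enc.enc (rawClause C) = encClause C := by
  change encList ((List.ofFn (code C)).map Enc.enc) = _
  rw [List.map_ofFn, encClause]
  congr 2
  funext i
  exact enc_code C i

theorem enc_map_rawLine (Γ : Proof n) : Enc.enc (Γ.map rawLine) = encProof Γ := by
  change encList ((Γ.map rawLine).map Enc.enc) = _
  rw [List.map_map, encProof]
  congr 2
  funext L
  change Data.cons (Enc.enc (rawClause L.clause)) (encJust L.just) = _
  rw [enc_rawClause]
  rfl

theorem simulate_raw (π : Equiv.Perm (Fin n)) (G : List (List Code × Just)) :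
    simulate (rawPerm π) G = (toProof π (processAll (rawPerm π) G)).map rawLine := by
  simp only [simulate, toProof, List.map_map]
  congr 1
  funext E
  simp [rawLine, unsorted_rawPerm]

theorem length_eq_of_encProof_eq {P Q : Proof n} (h : encProof P = encProof Q) :
    P.length = Q.length := by
  have key : ∀ l m : List Data, encList l = encList m → l = m := by
    intro l
    induction l with
    | nil => intro m h; cases m <;> simp_all [encList]
    | cons a l ih =>
      intro m h
      cases m with
      | nil => simp [encList] at h
      | cons b m =>
        simp only [encList, Data.cons.injEq] at h
        rw [h.1, ih m h.2]
  simpa using congrArg List.length (key _ _ h)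

/-! Functions on lists in polynomial time. -/

section

variable {α β γ δ : Type} [Enc α] [Enc β] [Enc γ] [Enc δ]

theorem sz_append (l m : List α) : sz (l ++ m) + 1 = sz l + sz m := by
  induction l with
  | nil => rw [List.nil_append, sz_nil]; omega
  | cons b l ih => rw [List.cons_append, sz_cons, sz_cons]; omega

theorem sz_reverse (l : List α) : sz l.reverse = sz l := by
  induction l with
  | nil => rfl
  | cons b l ih =>
    have := sz_append l.reverse [b]
    rw [List.reverse_cons, sz_cons]
    rw [sz_cons, sz_nil] at this
    omega

namespace PolyTime

theorem reverse : PolyTime fun l : List α => l.reverse := by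
  have key : ∀ m s : List α, m.foldl (fun s a => a :: s) s = m.reverse ++ s := by
    intro m
    induction m with
    | nil => intro s; rfl
    | cons a m ih => intro s; simp [ih]
  refine (foldl (l := fun l : List α => l) (s := fun _ => []) (f := fun _ s a => a :: s)
    (B := fun l => sz l) id (const _) (list_cons (snd.comp snd) (fst.comp snd)) .size
    fun l l' h => ?_).congr fun l => ?_
  · rw [key, List.append_nil, sz_reverse]
    exact sz_prefix_le h
  · rw [key, List.append_nil]

theorem map {l : γ → List α} {f : γ → α → β} (hl : PolyTime l)
    (hf : PolyTime fun x : γ × α => f x.1 x.2) : PolyTime fun c => (l c).map (f c) := by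
  obtain ⟨T, hT⟩ := hf.bound
  have hB := (PolyBound.size.add hl.bound).add (.const (α := γ) 1)
  have key : ∀ c (m : List α) (s : List β),
      m.foldl (fun s a => f c a :: s) s = (m.map (f c)).reverse ++ s := by
    intro c m
    induction m with
    | nil => intro s; rfl
    | cons a m ih => intro s; simp [ih]
  refine (reverse.comp (foldl (s := fun _ : γ => []) (f := fun c s a => f c a :: s) hl (const _)
    (list_cons (hf.comp (pair fst (snd.comp snd))) (fst.comp snd))
    (((hl.bound).mul ((hB.eval T).add (.const 1))).add (.const 1)) ?_)).congr ?_
  · intro c l' hl'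
    rw [key, List.append_nil, sz_reverse]
    have h1 : ∀ b ∈ l'.map (f c), sz b ≤ T.eval (sz c + sz (l c) + 1) := by
      intro b hb
      obtain ⟨a, ha, rfl⟩ := List.mem_map.1 hb
      refine (hT (c, a)).trans (eval_mono T ?_)
      have := sz_le_of_mem (hl'.subset ha)
      rw [sz_pair]
      omega
    refine (sz_list_le h1).trans (Nat.add_le_add_right (Nat.mul_le_mul_right _ ?_) 1)
    rw [List.length_map]
    exact hl'.length_le.trans (length_le_sz _)
  · intro c
    rw [key, List.append_nil, List.reverse_reverse]

theorem findSome? {l : γ → List α} {f : γ → α → Option β} (hl : PolyTime l)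
    (hf : PolyTime fun x : γ × α => f x.1 x.2) : PolyTime fun c => (l c).findSome? (f c) := by
  obtain ⟨T, hT⟩ := hf.bound
  have hB := (PolyBound.size.add hl.bound).add (.const (α := γ) 1)
  have key : ∀ c (m : List α) (s : Option β), m.foldl (fun s a => s.elim (f c a) some) s =
      s.elim (m.findSome? (f c)) some := by
    intro c m
    induction m with
    | nil => intro s; cases s <;> rfl
    | cons a m ih =>
      intro s
      rw [List.foldl_cons, ih, List.findSome?_cons]
      cases s <;> rcases f c a <;> rfl
  refine (foldl (s := fun _ : γ => none) (f := fun c s a => s.elim (f c a) Option.some) hl (const _)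
    (option_elim (fst.comp snd) (hf.comp (pair fst (snd.comp snd))) (option_some snd))
    ((hB.eval T).add (.const 1)) ?_).congr ?_
  · intro c l' hl'
    rw [key]
    change sz (l'.findSome? (f c)) ≤ _
    rcases h : l'.findSome? (f c) with _ | b
    · rw [sz_none]; omega
    · obtain ⟨a, ha, hab⟩ := List.exists_of_findSome?_eq_some h
      rw [← hab]
      refine ((hT (c, a)).trans (eval_mono T ?_)).trans (Nat.le_add_right _ 1)
      have := sz_le_of_mem (hl'.subset ha)
      rw [sz_pair]
      omega
  · intro c
    rw [key]
    rfl

theorem length : PolyTime fun l : List α => l.length := by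
  have key : ∀ (m : List α) (k : ℕ), m.foldl (fun k _ => k + 1) k = k + m.length := by
    intro m
    induction m with
    | nil => intro k; rfl
    | cons a m ih => intro k; rw [List.foldl_cons, ih, List.length_cons]; omega
  refine (foldl (l := fun l : List α => l) (s := fun _ => 0) (f := fun _ k _ => k + 1)
    (B := fun l => 2 * sz l + 1) id (const _) (nat_succ (fst.comp snd))
    (((PolyBound.const 2).mul .size).add (.const 1)) ?_).congr ?_
  · intro l l' h
    rw [key, sz_nat]
    have := h.length_le
    have := length_le_sz l
    omega
  · intro l
    rw [key, Nat.zero_add]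

/-- A number as a list. -/
theorem units : PolyTime fun k : ℕ => List.replicate k () :=
  of_enc_eq fun k => by
    induction k with
    | zero => rfl
    | succ k ih => exact congrArg (Data.cons Data.nil) ih

theorem drop : PolyTime fun x : ℕ × List α => x.2.drop x.1 := by
  have key : ∀ (m : List Unit) (s : List α), m.foldl (fun s _ => s.tail) s = s.drop m.length := by
    intro m
    induction m with
    | nil => intro s; rfl
    | cons a m ih =>
      intro s
      rw [List.foldl_cons, ih, List.length_cons, ← List.drop_one, List.drop_drop, Nat.add_comm]
  refine (foldl (l := fun x : ℕ × List α => List.replicate x.1 ()) (s := fun x => x.2)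
    (f := fun _ s _ => s.tail) (B := fun x => sz x) (units.comp fst) snd
    (list_tail.comp (fst.comp snd)) .size ?_).congr ?_
  · intro x l' _
    rw [key, sz_pair]
    have := one_le_sz x.1
    have := sz_suffix_le (List.drop_suffix l'.length x.2)
    omega
  · intro x
    rw [key, List.length_replicate]

theorem sub : PolyTime fun x : ℕ × ℕ => x.2 - x.1 := by
  have key : ∀ (m : List Unit) (k : ℕ), m.foldl (fun k _ => k - 1) k = k - m.length := by
    intro m
    induction m with
    | nil => intro s; rfl
    | cons a m ih => intro s; rw [List.foldl_cons, ih, List.length_cons]; omega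
  refine (foldl (l := fun x : ℕ × ℕ => List.replicate x.1 ()) (s := fun x => x.2)
    (f := fun _ k _ => k - 1) (B := fun x => sz x) (units.comp fst) snd
    (nat_pred.comp (fst.comp snd)) .size ?_).congr ?_
  · intro x l' _
    rw [key, sz_pair, sz_nat, sz_nat, sz_nat]
    have := Nat.sub_le x.2 l'.length
    omega
  · intro x
    rw [key, List.length_replicate]

theorem nat_beq : PolyTime fun x : ℕ × ℕ => x.1 == x.2 :=
  ((nat_eq_zero.comp sub).and (nat_eq_zero.comp (sub.comp (pair snd fst)))).congr fun x => by
    rw [Bool.eq_iff_iff]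
    simp
    omega

theorem zip : PolyTime fun x : List α × List β => x.1.zip x.2 := by
  have key : ∀ (m : List α) (s : List (α × β) × List β),
      m.foldl (fun s a => (uncons s.2).elim s fun y => ((a, y.1) :: s.1, y.2)) s =
        ((m.zip s.2).reverse ++ s.1, s.2.drop m.length) := by
    intro m
    induction m with
    | nil => intro s; rfl
    | cons a m ih =>
      intro s
      obtain ⟨s, r⟩ := s
      rw [List.foldl_cons, ih]
      cases r <;> simp [OrdRes.uncons]
  have hzip : ∀ (m : List α) (r : List β), sz (m.zip r) ≤ sz m + sz r := by
    intro m
    induction m with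
    | nil => intro r; rw [List.zip_nil_left, sz_nil]; have := one_le_sz r; omega
    | cons a m ih =>
      intro r
      cases r with
      | nil => rw [List.zip_nil_right, sz_nil]; have := one_le_sz (a :: m); omega
      | cons b r =>
        have := ih r
        rw [List.zip_cons_cons, sz_cons, sz_cons, sz_cons, sz_pair]
        omega
  refine (reverse.comp (fst.comp (foldl (l := fun x : List α × List β => x.1)
    (s := fun x => ([], x.2))
    (f := fun _ s a => (OrdRes.uncons s.2).elim s fun y => ((a, y.1) :: s.1, y.2))
    (B := fun x => 2 * sz x + 2) fst (pair (const _) snd)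
    ?_ (((PolyBound.const 2).mul .size).add (.const 2)) ?_))).congr ?_
  · refine option_elim (list_uncons.comp (snd.comp (fst.comp snd))) (fst.comp snd)
      (pair (list_cons (pair (snd.comp (snd.comp fst)) (fst.comp snd))
        (fst.comp (fst.comp (snd.comp fst)))) (snd.comp snd))
  · intro x l' hl'
    rw [key, List.append_nil, sz_pair, sz_reverse, sz_pair]
    have h1 := hzip l' x.2
    have h2 := sz_prefix_le hl'
    have h3 := sz_suffix_le (List.drop_suffix l'.length x.2)
    dsimp only at h1 h2 h3 ⊢
    omega
  · intro x
    rw [key, List.append_nil, List.reverse_reverse]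

theorem option_isNone : PolyTime fun o : Option α => o.isNone :=
  (option_elim id (const true) (g := fun _ _ => false) (const false)).congr fun o => by
    cases o <;> rfl

theorem code_beq : PolyTime fun x : Code × Code => x.1 == x.2 := by
  refine (option_elim (o := fun x : Code × Code => x.1) (f := fun x => x.2.isNone)
    (g := fun x b => x.2.elim false fun b' => bif b then b' else !b') fst
    (option_isNone.comp snd) (option_elim (snd.comp fst) (const _)
      (cond (snd.comp fst) snd snd.not))).congr fun x => ?_
  obtain ⟨a, c⟩ := x
  revert a c
  decide

theorem or {c d : α → Bool} (hc : PolyTime c) (hd : PolyTime d) : PolyTime fun a => c a || d a :=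
  (hc.cond (const true) hd).congr fun a => by cases c a <;> rfl

end PolyTime

end

/-! The simulation takes polynomial time. -/

namespace PolyTime

/-- The recursion on two lists becomes a fold over the trail; the accumulator is the rest of the
clause, or `none` after a failure. -/
theorem fits : PolyTime fun x : List Code × Trail => fits x.1 x.2 := by
  set step : Option (List Code) → Code × Option (ℕ × List Code) → Option (List Code) := fun s f =>
    s.elim none fun r => (OrdRes.uncons r).elim none fun y =>
      bif y.1 == none || y.1 == f.1 then some y.2 else none with hstep
  have hnone : ∀ F : Trail, F.foldl step none = none := by
    intro F
    induction F with
    | nil => rfl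
    | cons f F ih => rw [List.foldl_cons]; exact ih
  have key : ∀ (F : Trail) (r : List Code),
      OrdRes.fits r F = (F.foldl step (some r)).elim false fun r => r.isEmpty := by
    intro F
    induction F with
    | nil => intro r; cases r <;> rfl
    | cons f F ih =>
      intro r
      rw [List.foldl_cons]
      cases r with
      | nil => rw [show step (some []) f = none from rfl, hnone]; rfl
      | cons a r =>
        have h1 : step (some (a :: r)) f = bif a == none || a == f.1 then some r else none := rfl
        rw [h1, OrdRes.fits, ih]
        cases (a == none || a == f.1)
        · simp [hnone]
        · simp
  have hsz : ∀ (F : Trail) (r : List Code), sz (F.foldl step (some r)) ≤ sz r + 2 := by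
    intro F
    induction F with
    | nil => intro r; rw [List.foldl_nil, sz_some]
    | cons f F ih =>
      intro r
      rw [List.foldl_cons]
      cases r with
      | nil => rw [show step (some []) f = none from rfl, hnone, sz_none]; omega
      | cons a r =>
        have h1 : step (some (a :: r)) f = bif a == none || a == f.1 then some r else none := rfl
        rw [h1]
        cases (a == none || a == f.1)
        · rw [cond_false, hnone, sz_none]; omega
        · have := ih r
          rw [cond_true, sz_cons]
          omega
  refine (option_elim (foldl (l := fun x : List Code × Trail => x.2) (s := fun x => some x.1)
    (f := fun _ => step) (B := fun x => sz x + 2) snd (option_some fst) ?_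
    (PolyBound.size.add (.const 2)) ?_) (const false) (g := fun _ r => r.isEmpty)
    (list_isEmpty.comp snd)).congr fun x => key _ _
  · refine option_elim (fst.comp snd) (const none) (option_elim (list_uncons.comp snd) (const none)
      (cond (or (code_beq.comp (pair (fst.comp snd) (const none))) (code_beq.comp (pair
        (fst.comp snd) (fst.comp (snd.comp (snd.comp (fst.comp fst)))))))
        (option_some (snd.comp snd)) (const none)))
  · intro x l' _
    have := hsz l' x.1
    rw [sz_pair]
    omega

theorem bool_beq : PolyTime fun x : Bool × Bool => x.1 == x.2 :=
  (cond fst snd snd.not).congr fun x => by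
    obtain ⟨b, c⟩ := x
    revert b c
    decide

theorem candidate : PolyTime fun x : (Bool × Trail) × Entry => candidate x.1.1 x.1.2 x.2 := by
  refine (option_elim (o := fun x : (Bool × Trail) × Entry => OrdRes.uncons x.2.2.1)
    (f := fun _ => none) (g := fun x y => y.1.elim none fun b' =>
      bif b' == x.1.1 && OrdRes.fits y.2 x.1.2 then some (x.2.1, y.2) else none)
    (list_uncons.comp (fst.comp (snd.comp snd))) (const none)
    (option_elim (fst.comp snd) (const none) (cond
      (and (bool_beq.comp (pair snd (fst.comp (fst.comp (fst.comp fst)))))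
        (fits.comp (pair (snd.comp (snd.comp fst)) (snd.comp (fst.comp (fst.comp fst))))))
        (option_some (pair (fst.comp (snd.comp (fst.comp fst))) (snd.comp (snd.comp fst))))
        (const none)))).congr fun x => ?_
  obtain ⟨⟨b, F⟩, i, cl, J⟩ := x
  rcases cl with _ | ⟨_ | b', r⟩
  · rfl
  · rfl
  · simp only [OrdRes.candidate, OrdRes.uncons, Option.elim]
    cases (b' == b && OrdRes.fits r F) <;> rfl

theorem search (b : Bool) : PolyTime fun x : Trail × List Entry => search b x.1 x.2 :=
  findSome? (f := fun (x : Trail × List Entry) E => OrdRes.candidate b x.1 E) snd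
    (candidate.comp (pair (pair (const b) (fst.comp fst)) snd))

theorem merge : PolyTime fun x : List Code × List Code => merge x.1 x.2 := by
  refine (map (f := fun _ (y : Code × Code) => y.1.elim y.2 some) zip
    (option_elim (fst.comp snd) (snd.comp snd) (option_some snd))).congr fun x => ?_
  rw [OrdRes.merge, List.zip, List.map_zipWith]
  congr 1
  funext a c
  cases a <;> rfl

/-- The list serves as its own clock: each step removes one leading `none`, and nothing changes once
a literal is at the head. -/
theorem strip : PolyTime fun l : List Code => strip l := by
  set step : List Code → List Code := fun s =>
    (OrdRes.uncons s).elim s fun y => bif y.1.isNone then y.2 else s with hstep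
  have key : ∀ (m s : List Code), s.length ≤ m.length →
      m.foldl (fun s _ => step s) s = OrdRes.strip s := by
    intro m
    induction m with
    | nil => intro s h; rw [List.length_nil, Nat.le_zero, List.length_eq_zero_iff] at h; rw [h]; rfl
    | cons a m ih =>
      intro s h
      rw [List.foldl_cons]
      have hfix : ∀ (m s : List Code), step s = s → m.foldl (fun s _ => step s) s = s := by
        intro m
        induction m with
        | nil => intro s _; rfl
        | cons a m ih => intro s hs; rw [List.foldl_cons, hs, ih s hs]
      rcases s with _ | ⟨_ | b, s⟩
      · exact ih [] (Nat.zero_le _)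
      · exact ih s (Nat.le_of_succ_le_succ h)
      · exact hfix m _ rfl
  have hsuf : ∀ (m s : List Code), m.foldl (fun s _ => step s) s <:+ s := by
    intro m
    induction m with
    | nil => intro s; exact List.suffix_rfl
    | cons a m ih =>
      intro s
      refine (ih _).trans ?_
      rcases s with _ | ⟨_ | b, s⟩
      · exact List.suffix_rfl
      · exact List.suffix_cons _ _
      · exact List.suffix_rfl
  refine (foldl (l := fun l : List Code => l) (s := fun l => l) (f := fun _ s _ => step s)
    (B := fun l => sz l) id id ?_ .size fun l l' _ => sz_suffix_le (hsuf l' l)).congr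
    fun l => (key l l le_rfl).symm
  exact option_elim (list_uncons.comp (fst.comp snd)) (fst.comp snd)
    (cond (option_isNone.comp (fst.comp snd)) (snd.comp snd) (fst.comp (snd.comp fst)))

theorem res {α : Type} [Enc α] {j k : α → ℕ} (hj : PolyTime j) (hk : PolyTime k) :
    PolyTime fun a => Just.res (j a) (k a) := of_cons hj hk fun _ => rfl

theorem push : PolyTime fun x : List Entry × ℕ × ℕ × List Code =>
    push x.1 x.2.1 x.2.2.1 x.2.2.2 :=
  list_cons (pair (length.comp fst) (pair (strip.comp (snd.comp (snd.comp snd)))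
    (res (fst.comp snd) (fst.comp (snd.comp snd))))) fst

/-- Positions count from the end of the list, so they are indices in the reversed list. -/
theorem codeAt : PolyTime fun x : ℕ × List Code => codeAt x.2 x.1 := by
  refine (option_elim (list_uncons.comp (drop.comp (pair fst (reverse.comp snd)))) (const none)
    (g := fun _ y => y.1) (fst.comp snd)).congr fun x => ?_
  obtain ⟨k, l⟩ := x
  dsimp only
  induction l with
  | nil => simp [OrdRes.codeAt, OrdRes.uncons]
  | cons a l ih =>
    rw [OrdRes.codeAt, List.reverse_cons]
    rcases lt_trichotomy k l.length with h | rfl | h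
    · rw [if_neg h.ne, ih, List.drop_append_of_le_length (by simp; omega),
        List.drop_eq_getElem_cons (by simpa using h)]
      rfl
    · rw [if_pos rfl, List.drop_append_of_le_length (by simp), List.drop_of_length_le (by simp)]
      rfl
    · rw [if_neg h.ne', codeAt_of_length_le h.le, List.drop_of_length_le (by simp; omega)]
      rfl

theorem positions : PolyTime fun p : List ℕ => positions p := by
  have key : ∀ (m : List ℕ) (k : ℕ), m.foldl (fun s _ => s.length :: s) (List.range k).reverse =
      (List.range (k + m.length)).reverse := by
    intro m
    induction m with
    | nil => intro k; rfl
    | cons a m ih =>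
      intro k
      have := ih (k + 1)
      rw [List.range_succ, List.reverse_append] at this
      rw [List.foldl_cons, List.length_reverse, List.length_range, List.length_cons]
      rw [show k + (m.length + 1) = k + 1 + m.length by omega]
      exact this
  have key0 := fun m => key m 0
  simp only [List.range_zero, List.reverse_nil, Nat.zero_add] at key0
  refine (foldl (l := fun p : List ℕ => p) (s := fun _ => []) (f := fun _ s _ => s.length :: s)
    (B := fun p => sz p * (2 * sz p + 1 + 1) + 1) id (const _)
    (list_cons (length.comp (fst.comp snd)) (fst.comp snd))
    ((PolyBound.size.mul ((((PolyBound.const 2).mul .size).add (.const 1)).add (.const 1))).add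
      (.const 1)) fun p l' h => ?_).congr fun p => (key0 p).symm
  rw [key0]
  have h1 := h.length_le.trans (length_le_sz p)
  refine (sz_list_le (M := 2 * sz p + 1) fun k hk => ?_).trans ?_
  · simp only [List.mem_reverse, List.mem_range] at hk
    rw [sz_nat]
    omega
  · rw [List.length_reverse, List.length_range]
    exact Nat.add_le_add_right (Nat.mul_le_mul_right _ h1) 1

theorem sorted : PolyTime fun x : List ℕ × List Code => sorted x.1 x.2 := by
  refine map (f := fun (x : List ℕ × List Code) k => (x.1.zip x.2).findSome? fun y : ℕ × Code =>
    bif y.1 == k then y.2 else none) (positions.comp fst) ?_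
  exact findSome? (γ := (List ℕ × List Code) × ℕ) (l := fun z => z.1.1.zip z.1.2)
    (f := fun z (y : ℕ × Code) => bif y.1 == z.2 then y.2 else none) (zip.comp fst)
    (cond (nat_beq.comp (pair (fst.comp snd) (snd.comp fst))) (snd.comp snd) (const none))

theorem unsorted : PolyTime fun x : List ℕ × List Code => unsorted x.1 x.2 :=
  map (f := fun (x : List ℕ × List Code) k => OrdRes.codeAt x.2 k) fst
    (codeAt.comp (pair snd (snd.comp fst)))

end PolyTime

/-! ### Size bounds and polynomial time for reduction and scan -/

theorem sz_code_le (c : Code) : sz c ≤ 5 := by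
  rcases c with _ | _ | _ <;> decide

theorem sz_codes_le (l : List Code) : sz l ≤ l.length * 6 + 1 := sz_list_le fun c _ => sz_code_le c

theorem sz_entry (E : Entry) : sz E = sz E.1 + (sz E.2.1 + sz E.2.2 + 1) + 1 := rfl

theorem sz_push_le (S : List Entry) (j k : ℕ) (u : List Code) :
    sz (push S j k u) ≤ 3 * sz S + 6 * u.length + 2 * j + 2 * k + 8 := by
  rw [push, sz_cons, sz_pair, sz_pair, sz_res, sz_nat]
  have h1 := length_le_sz S
  have h2 := sz_codes_le (strip u)
  have h3 := length_strip_le u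
  omega

/-- A step of the reduction. -/
def reduceStep (s : List Entry × List Code) (f : Code × Option (ℕ × List Code)) :
    List Entry × List Code :=
  -- At an assumption the clause is replaced by `[]`, on which all later steps are idle; so the fold
  -- stops there in effect.
  (uncons s.2).elim s fun y => y.1.elim (s.1, y.2) fun _ => f.2.elim (s.1, []) fun R =>
    (push s.1 (s.1.length - 1) R.1 (merge y.2 R.2), merge y.2 R.2)

theorem foldl_reduceStep (S : List Entry) (g : List Code) (F : Trail) :
    (F.foldl reduceStep (S, g)).1 = reduce S g F := by
  have hnil : ∀ (F : Trail) (S : List Entry), F.foldl reduceStep (S, []) = (S, []) := by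
    intro F
    induction F with
    | nil => intro S; rfl
    | cons f F ih => intro S; rw [List.foldl_cons]; exact ih S
  fun_induction reduce S g F with
  | case1 S f g F ih => exact ih
  | case2 S b g a R F ih => exact ih
  | case3 S b g a F =>
    rw [List.foldl_cons]
    exact congrArg Prod.fst (hnil F S)
  | case4 S F => rw [hnil]
  | case5 => rfl

/-- Iterating `sz_push_le` would compound its factor 3. Instead the number of lines, the length of
the clause and the size of each line are bounded separately throughout. -/
theorem foldl_reduceStep_bound {N L K B : ℕ}
    (hB : 2 * N + 1 + (6 * L + 1) + (2 * N + K + 3) + 2 ≤ B) (F : Trail)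
    (s : List Entry × List Code) (h1 : s.1.length + F.length ≤ N) (h2 : s.2.length ≤ L)
    (h3 : ∀ f ∈ F, sz f ≤ K) (h4 : ∀ E ∈ s.1, sz E ≤ B) :
    (F.foldl reduceStep s).1.length ≤ N ∧ (F.foldl reduceStep s).2.length ≤ L ∧
      ∀ E ∈ (F.foldl reduceStep s).1, sz E ≤ B := by
  induction F generalizing s with
  | nil => exact ⟨by simpa using h1, h2, h4⟩
  | cons f F ih =>
    rw [List.foldl_cons]
    rw [List.length_cons] at h1
    have h3' : ∀ f ∈ F, sz f ≤ K := fun f hf => h3 f (List.mem_cons_of_mem _ hf)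
    obtain ⟨S, g⟩ := s
    dsimp only at h1 h2 h4
    rcases g with _ | ⟨_ | b, g⟩
    · exact ih _ (by change S.length + F.length ≤ N; omega) h2 h3' h4
    · rw [List.length_cons] at h2
      exact ih (S, g) (by dsimp only; omega) (by dsimp only; omega) h3' h4
    · rw [List.length_cons] at h2
      obtain ⟨f1, _ | R⟩ := f
      · exact ih (S, []) (by dsimp only; omega) (by simp) h3' h4
      · have hR := h3 _ List.mem_cons_self
        rw [sz_pair, sz_some, sz_pair, sz_nat] at hR
        have hm : (merge g R.2).length ≤ L := by
          simp only [merge, List.length_zipWith]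
          omega
        refine ih (push S (S.length - 1) R.1 (merge g R.2), merge g R.2) ?_ hm h3' ?_
        · simp only [push, List.length_cons]
          omega
        · intro E hE
          rcases List.mem_cons.1 hE with rfl | hE
          · rw [sz_pair, sz_pair, sz_res, sz_nat]
            have h5 := sz_codes_le (strip (merge g R.2))
            have h6 := length_strip_le (merge g R.2)
            omega
          · exact h4 E hE

namespace PolyTime

theorem reduceStep : PolyTime fun x : (List Entry × List Code) × Code × Option (ℕ × List Code) =>
    reduceStep x.1 x.2 := by
  refine option_elim (list_uncons.comp (snd.comp fst)) fst (option_elim (fst.comp snd)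
    (pair (fst.comp (fst.comp fst)) (snd.comp snd)) (option_elim
      (snd.comp (snd.comp (fst.comp fst)))
      (pair (fst.comp (fst.comp (fst.comp fst))) (const [])) ?_))
  have hS : PolyTime fun x : ((((List Entry × List Code) × Code × Option (ℕ × List Code)) ×
    Code × List Code) × Bool) × ℕ × List Code => x.1.1.1.1.1 :=
    fst.comp (fst.comp (fst.comp (fst.comp fst)))
  have hm : PolyTime fun x : ((((List Entry × List Code) × Code × Option (ℕ × List Code)) ×
    Code × List Code) × Bool) × ℕ × List Code => OrdRes.merge x.1.1.2.2 x.2.2 :=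
    merge.comp (pair (snd.comp (snd.comp (fst.comp fst))) (snd.comp snd))
  exact pair (push.comp (pair hS (pair (nat_pred.comp (length.comp hS))
    (pair (fst.comp snd) hm)))) hm

theorem reduce : PolyTime fun x : List Entry × List Code × Trail => reduce x.1 x.2.1 x.2.2 := by
  set B : List Entry × List Code × Trail → ℕ := fun x => 20 * sz x + 10 with hB
  have hBp : PolyBound B := ((PolyBound.const 20).mul .size).add (.const 10)
  refine (fst.comp (foldl (l := fun x : List Entry × List Code × Trail => x.2.2)
    (s := fun x => (x.1, x.2.1)) (f := fun _ => OrdRes.reduceStep) (snd.comp snd)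
    (pair fst (fst.comp snd)) (reduceStep.comp snd)
    (((PolyBound.size.mul (hBp.add (.const 1))).add (.const 1)).add
      ((PolyBound.const 6).mul .size |>.add (.const 2))) ?_)).congr fun x =>
    (foldl_reduceStep _ _ _).symm
  rintro ⟨S, g, F⟩ l' hl'
  have e1 : sz (S, g, F) = sz S + (sz g + sz F + 1) + 1 := rfl
  have e2 := length_le_sz S
  have e3 := length_le_sz g
  have e4 := hl'.length_le
  have e5 := length_le_sz F
  dsimp only at e4
  obtain ⟨h1, h2, h3⟩ := foldl_reduceStep_bound (N := S.length + F.length) (L := g.length)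
    (K := sz F) (B := B (S, g, F)) (by simp only [hB]; omega) l' (S, g) (by dsimp only; omega)
    le_rfl (fun f hf => sz_le_of_mem (hl'.subset hf))
    (fun E hE => by have := sz_le_of_mem hE; simp only [hB]; dsimp only at this; omega)
  have h4 := sz_list_le h3
  have h5 := sz_codes_le (l'.foldl OrdRes.reduceStep (S, g)).2
  have h6 := Nat.mul_le_mul_right (B (S, g, F) + 1) (h1.trans (show _ ≤ sz (S, g, F) by omega))
  rw [show l'.foldl OrdRes.reduceStep (S, g) = ((l'.foldl OrdRes.reduceStep (S, g)).1,
    (l'.foldl OrdRes.reduceStep (S, g)).2) from rfl, sz_pair]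
  omega

theorem scanStep : PolyTime fun x : Code × List Entry × Option Trail => scanStep x.1 x.2 := by
  have hS : PolyTime fun x : (Code × List Entry × Option Trail) × Trail => x.1.2.1 :=
    fst.comp (snd.comp fst)
  refine (option_elim (o := fun x : Code × List Entry × Option Trail => x.2.2)
    (f := fun x => x.2)
    (g := fun x F => x.1.elim
      ((OrdRes.search true F x.2.1).elim
        ((OrdRes.search false F x.2.1).elim (x.2.1, some ((none, none) :: F))
          fun R' => (x.2.1, some ((some true, some R') :: F)))
        fun R => (OrdRes.search false F x.2.1).elim (x.2.1, some ((some false, some R) :: F))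
          fun R' => (OrdRes.reduce (OrdRes.push x.2.1 R.1 R'.1 (OrdRes.merge R.2 R'.2))
            (OrdRes.merge R.2 R'.2) F, none))
      fun b => (x.2.1, some ((some b, none) :: F)))
    (snd.comp snd) snd (option_elim (fst.comp fst)
      (option_elim ((search true).comp (pair snd hS))
        (option_elim ((search false).comp (pair snd hS))
          (pair hS (option_some (list_cons (const _) snd)))
          (pair (hS.comp fst) (option_some (list_cons (pair (const _) (option_some snd))
            (snd.comp fst)))))
        (option_elim ((search false).comp (pair (snd.comp fst) (hS.comp fst)))
          (pair (hS.comp fst) (option_some (list_cons (pair (const _) (option_some snd))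
            (snd.comp fst)))) ?_))
      (pair (hS.comp fst) (option_some (list_cons (pair (option_some snd) (const _))
        (snd.comp fst)))))).congr ?_
  · have hm : PolyTime fun x : (((Code × List Entry × Option Trail) × Trail) × ℕ × List Code) ×
        ℕ × List Code => OrdRes.merge x.1.2.2 x.2.2 :=
      merge.comp (pair (snd.comp (snd.comp fst)) (snd.comp snd))
    exact pair (reduce.comp (pair (push.comp (pair (hS.comp (fst.comp fst))
      (pair (fst.comp (snd.comp fst)) (pair (fst.comp snd) hm))))
      (pair hm (snd.comp (fst.comp fst))))) (const _)
  · rintro ⟨c, S, _ | F⟩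
    · rfl
    · rcases c with _ | b
      · simp only [OrdRes.scanStep, Option.elim]
        rcases OrdRes.search true F S with _ | R <;> rcases OrdRes.search false F S with _ | R' <;>
          rfl
      · rfl

end PolyTime

theorem sz_reason_le {S : List Entry} {R : ℕ × List Code} {b : Bool} {E : Entry} (hE : E ∈ S)
    (h1 : E.1 = R.1) (h2 : E.2.1 = some b :: R.2) : sz R ≤ sz S := by
  have h3 := sz_le_of_mem hE
  rw [sz_entry, h1, h2, sz_cons] at h3
  have h4 : sz R = sz R.1 + sz R.2 + 1 := rfl
  omega

theorem TrailOK.sz_le {S : List Entry} {e : List Code} {F : Trail} (h : TrailOK S e F) :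
    sz F ≤ e.length * (sz S + 9) + 1 := by
  have key : ∀ f ∈ F, sz f ≤ sz S + 8 := by
    induction e generalizing F with
    | nil => cases F <;> simp_all [TrailOK]
    | cons c e ih =>
      cases F with
      | nil => simp
      | cons f F =>
        intro f' hf'
        rcases List.mem_cons.1 hf' with rfl | hf'
        · obtain ⟨f1, f2⟩ := f'
          rw [sz_pair]
          have := sz_code_le f1
          rcases h.2 with ⟨-, h2⟩ | ⟨b, R, h2, -, E, hE, h3, h4⟩
          · dsimp only at h2
            rw [h2, sz_none]
            omega
          · obtain rfl : f2 = some R := (Prod.ext_iff.1 h2).2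
            rw [sz_some]
            have := sz_reason_le hE h3 h4
            omega
        · exact ih h.1 f' hf'
  rw [← h.length_eq]
  exact sz_list_le key

namespace PolyTime

/-- Until a conflict the lines remain `S` and the trail only holds copies of parts of `S`. A
conflict occurs at most once, so the polynomial bound for `reduce` is applied once and not iterated.
-/
theorem scan : PolyTime fun x : List Entry × List Code => (scan x.1 x.2).1 := by
  obtain ⟨T, hT⟩ := reduce.bound
  set W : List Entry × List Code → ℕ := fun x => sz x * (sz x + 9) + 1 with hW
  have hWp : PolyBound W := (PolyBound.size.mul (PolyBound.size.add (.const 9))).add (.const 1)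
  set V : List Entry × List Code → ℕ := fun x => W x + 20 * sz x + 20 with hV
  have hVp : PolyBound V := (hWp.add ((PolyBound.const 20).mul .size)).add (.const 20)
  refine (fst.comp (foldl (l := fun x : List Entry × List Code => x.2.reverse)
    (s := fun x => (x.1, some [])) (f := fun _ st c => OrdRes.scanStep c st) (reverse.comp snd)
    (pair fst (const _)) (scanStep.comp (pair (snd.comp snd) (fst.comp snd)))
    (((hVp.eval T).add hVp)) ?_)).congr ?_
  · rintro ⟨S, e⟩ l' hl'
    dsimp only at hl' ⊢
    have hlen := hl'.length_le
    rw [List.length_reverse] at hlen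
    -- Every intermediate state is itself the result of a scan, so `scan_spec` describes it.
    have hfold : l'.foldl (fun st c => OrdRes.scanStep c st) (S, some []) =
        OrdRes.scan S l'.reverse := by
      rw [OrdRes.scan, List.foldr_reverse]
    rw [hfold]
    have e1 : sz (S, e) = sz S + sz e + 1 := rfl
    have e2 := length_le_sz e
    have hw : ∀ k ≤ e.length, k * (sz S + 9) + 1 ≤ W (S, e) := by
      intro k hk
      exact Nat.add_le_add_right (Nat.mul_le_mul (by omega) (by omega)) 1
    rcases scan_spec S l'.reverse with ⟨F, h1, h2, -⟩ | ⟨e0, e', F, R, R', he, h2, h3, h4, h5⟩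
    · rw [h1, sz_pair, sz_some]
      have h3 := h2.sz_le.trans (hw _ (by rw [List.length_reverse]; exact hlen))
      simp only [hV]
      omega
    · have hel : e'.length ≤ e.length := by
        have := congrArg List.length he
        simp only [List.length_reverse, List.length_append, List.length_cons] at this
        omega
      obtain ⟨-, E, hE, h7, h8⟩ := exists_of_search h3
      obtain ⟨-, E', hE', h10, h11⟩ := exists_of_search h4
      have k1 := sz_reason_le hE h7 h8
      have k2 := sz_reason_le hE' h10 h11
      have k3 : sz R = sz R.1 + sz R.2 + 1 := rfl
      have k4 : sz R' = sz R'.1 + sz R'.2 + 1 := rfl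
      rw [sz_nat] at k3 k4
      have k5 := length_le_sz R.2
      have k6 : (OrdRes.merge R.2 R'.2).length ≤ R.2.length := by
        simp [OrdRes.merge]
      have k7 := sz_push_le S R.1 R'.1 (OrdRes.merge R.2 R'.2)
      have k8 := sz_codes_le (OrdRes.merge R.2 R'.2)
      have k9 := h2.sz_le.trans (hw _ hel)
      have k10 := (hT (OrdRes.push S R.1 R'.1 (OrdRes.merge R.2 R'.2), OrdRes.merge R.2 R'.2,
        F)).trans (eval_mono T (b := V (S, e)) (by
          rw [sz_pair, sz_pair]
          simp only [hV]
          omega))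
      rw [h5, sz_pair, sz_none]
      dsimp only at k10
      simp only [hV] at k10 ⊢
      omega
  · rintro ⟨S, e⟩
    rw [OrdRes.scan, List.foldl_reverse]

theorem process : PolyTime fun x : List ℕ × List Entry × List Code × Just =>
    process x.1 x.2.1 x.2.2 := by
  have hs : PolyTime fun x : List ℕ × List Entry × List Code × Just =>
      OrdRes.sorted x.1 x.2.2.1 := sorted.comp (pair fst (fst.comp (snd.comp snd)))
  refine of_ite (c := fun x : List ℕ × List Entry × List Code × Just => x.2.2.2)
    (f := fun x => (OrdRes.scan x.2.1 (OrdRes.sorted x.1 x.2.2.1)).1)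
    (g := fun x => (x.2.1.length, OrdRes.strip (OrdRes.sorted x.1 x.2.2.1), Just.ax) :: x.2.1)
    (snd.comp (snd.comp snd)) (scan.comp (pair (fst.comp snd) hs))
    (list_cons (pair (length.comp (fst.comp snd)) (pair (strip.comp hs) (const _)))
      (fst.comp snd)) ?_ ?_
  · rintro ⟨p, S, c, _ | ⟨j, k⟩⟩ h
    · exact absurd rfl h
    · rfl
  · rintro ⟨p, S, c, _ | ⟨j, k⟩⟩ h
    · rfl
    · simp [enc, encJust] at h

end PolyTime

/-! ### The program and the p-simulations -/

/-- The refutations that are to be simulated. -/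
abbrev Input : Type :=
  {x : Σ n : ℕ, Equiv.Perm (Fin n) × Proof n // ∃ τ, Refutes halfOrdered x.2.1 τ x.2.2}

instance : Enc Input := ⟨fun x => encInput x.1.2.1 x.1.2.2⟩

/-- Line numbers are smaller than the number of lines and clauses have length at most `n`, so
counting lines is enough to bound the size. -/
theorem sz_le_of_valid {n : ℕ} {π : Equiv.Perm (Fin n)} {τ : Set (Clause n)} {S : List Entry}
    (hv : Valid π τ S) : sz S ≤ S.length * (6 * S.length + 6 * n + 10) + 1 := by
  have key : ∀ (S : List Entry), Valid π τ S → ∀ E ∈ S, E.1 < S.length := by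
    intro S
    induction S with
    | nil => simp
    | cons A S ih =>
      intro h E hE
      rw [List.length_cons]
      rcases List.mem_cons.1 hE with rfl | hE
      · have := h.2.1; omega
      · have := ih h.1 E hE; omega
  have key2 : ∀ N, S.length ≤ N → ∀ E ∈ S, sz E ≤ 6 * N + 6 * n + 9 := by
    intro N hN
    induction S with
    | nil => simp
    | cons A S ih =>
      intro E hE
      rw [List.length_cons] at hN
      rcases List.mem_cons.1 hE with rfl | hE
      · obtain ⟨h1, h2, h3, h4⟩ := hv
        have h5 := sz_codes_le E.2.1
        rw [sz_entry, sz_nat]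
        have h6 : sz E.2.2 ≤ 4 * N + 3 := by
          rcases hJ : E.2.2 with _ | ⟨j, k⟩
          · rw [sz_ax]; omega
          · rw [hJ] at h4
            obtain ⟨A, hA, B, hB, rfl, rfl, -⟩ := h4
            have := key S h1 A hA
            have := key S h1 B hB
            rw [sz_res]
            omega
        omega
      · exact ih hv.1 (by omega) E hE
  exact sz_list_le (key2 _ le_rfl)

/-- Polynomial growth in each single `process` would not bound the whole fold. The bound comes from
the quadratic number of lines in `processAll_take`, which holds for genuine half-ordered proofs;
this is why the domain is `Input`. -/
theorem polyTime_simulate : PolyTime fun x : Input =>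
    simulate (rawPerm x.1.2.1) (x.1.2.2.map rawLine) := by
  have hp : PolyTime fun x : Input => rawPerm x.1.2.1 :=
    .of_head fun x => enc_rawPerm _
  have hG : PolyTime fun x : Input => x.1.2.2.map rawLine :=
    .of_tail fun x => enc_map_rawLine _
  have hall : PolyTime fun x : Input => processAll (rawPerm x.1.2.1) (x.1.2.2.map rawLine) := by
    have hN := hG.bound.mul hG.bound
    refine PolyTime.foldl (f := fun (x : Input) => process (rawPerm x.1.2.1)) hG (.const [])
      (PolyTime.process.comp (.pair (hp.comp .fst) .snd))
      (hN.mul ((((PolyBound.const 6).mul hN).add ((PolyBound.const 6).mul hp.bound)).add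
        (.const 10)) |>.add (.const 1)) ?_
    rintro ⟨⟨n, π, Γ⟩, τ, hΓ⟩ l' hl'
    dsimp only at hl' ⊢
    have hl : l' = (Γ.take l'.length).map rawLine := by
      rw [List.map_take]
      exact List.prefix_iff_eq_take.1 hl'
    have hle := hl'.length_le
    rw [List.length_map] at hle
    obtain ⟨h1, -, h2, -⟩ := processAll_take hΓ.1 l'.length hle
    rw [← hl] at h1 h2
    have h3 := sz_le_of_valid h1
    have h4 : l'.length ≤ sz (Γ.map rawLine) := hl'.length_le.trans (length_le_sz _)
    have h5 : n ≤ sz (rawPerm π) := by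
      have := length_le_sz (rawPerm π)
      simpa [rawPerm] using this
    refine h3.trans ?_
    have h6 := h2.trans (Nat.mul_le_mul h4 h4)
    gcongr
  exact PolyTime.map (PolyTime.reverse.comp hall) (f := fun (x : Input) (E : Entry) =>
    (unsorted (rawPerm x.1.2.1) E.2.1, E.2.2)) (.pair (PolyTime.unsorted.comp
      (.pair (hp.comp .fst) (PolyTime.fst.comp (PolyTime.snd.comp .snd))))
      (PolyTime.snd.comp (PolyTime.snd.comp .snd)))

theorem exists_isPSimulation : ∃ p : Prog, IsPSimulation ordered halfOrdered p ∧
    ∀ (n : ℕ), 1 ≤ n → ∀ (π : Equiv.Perm (Fin n)) (τ : Set (Clause n)) (Γ Δ : Proof n) (t : ℕ),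
      Refutes halfOrdered π τ Γ → Run p (encInput π Γ) (encProof Δ) t →
        Δ.length ≤ n * Γ.length := by
  obtain ⟨p, T, ⟨T', hT⟩, h⟩ := polyTime_simulate
  have key : ∀ (n : ℕ) (π : Equiv.Perm (Fin n)) (τ : Set (Clause n)) (Γ : Proof n),
      Refutes halfOrdered π τ Γ → ∃ t, Run p (encInput π Γ)
        (encProof (toProof π (processAll (rawPerm π) (Γ.map rawLine)))) t ∧
        t ≤ T'.eval (encInput π Γ).size := by
    intro n π τ Γ hΓ
    obtain ⟨t, h1, h2⟩ := h ⟨⟨n, π, Γ⟩, τ, hΓ⟩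
    refine ⟨t, ?_, h2.trans (hT _)⟩
    dsimp only at h1
    rw [simulate_raw, enc_map_rawLine] at h1
    exact h1
  -- The bound `n * Γ.length` is no polynomial in `Γ.length`, so the p-simulation uses the quadratic
  -- one.
  refine ⟨p, ⟨T', Polynomial.X * Polynomial.X, fun n π τ Γ hΓ => ?_⟩,
    fun n hn π τ Γ Δ t hΓ hr => ?_⟩
  · obtain ⟨t, h1, h2⟩ := key n π τ Γ hΓ
    obtain ⟨h3, -, h4⟩ := processAll_spec hΓ
    exact ⟨_, t, h1, h2, h3, by simpa using h4⟩
  · obtain ⟨t', h1, -⟩ := key n π τ Γ hΓ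
    rw [length_eq_of_encProof_eq (hr.deterministic h1)]
    exact (processAll_spec hΓ).2.1 hn

/-- The same proof serves; `Prog.tail` removes the order from the input. -/
theorem pSimulates_halfOrdered_ordered : PSimulates halfOrdered ordered := by
  refine ⟨Prog.tail, Polynomial.X, Polynomial.X, fun n π τ Γ hΓ =>
    ⟨Γ, (encInput π Γ).size, Run.tail _, by simp, ⟨fun t L hL => ?_, hΓ.2⟩, by simp⟩⟩
  · have h := hΓ.1 t L hL
    unfold LineOK at h ⊢
    split at h
    · exact h
    · obtain ⟨hj, hk, A, B, hA, hB, i, a, h1, h2, h3, h4⟩ := h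
      exact ⟨hj, hk, A, B, hA, hB, i, a, h1, h2,
        .inl fun l hl => h3 l (Finset.mem_union_left _ hl), h4⟩

end OrdRes

theorem theorem2p1 :
    OrdRes.PolyEquivalent OrdRes.ordered OrdRes.halfOrdered ∧
    ∃ p : OrdRes.Prog, OrdRes.IsPSimulation OrdRes.ordered OrdRes.halfOrdered p ∧
      ∀ (n : ℕ), 1 ≤ n → ∀ (π : Equiv.Perm (Fin n)) (τ : Set (OrdRes.Clause n))
        (Γ Δ : OrdRes.Proof n) (t : ℕ), OrdRes.Refutes OrdRes.halfOrdered π τ Γ →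
          OrdRes.Run p (OrdRes.encInput π Γ) (OrdRes.encProof Δ) t →
          Δ.length ≤ n * Γ.length := by
  obtain ⟨p, hp⟩ := OrdRes.exists_isPSimulation
  exact ⟨⟨⟨p, hp.1⟩, OrdRes.pSimulates_halfOrdered_ordered⟩, p, hp⟩
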